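/- Call a locally compact Hausdorff topological group an $\ell$-group if its compact open subgroups form a fundamental system of neighbourhoods of the identity. For an $\ell$-group $J$, let $\mathrm{Alg}(J)$ be the category of smooth complex representations of $J$ (every vector has open stabilizer); a character of $J$ is a smooth homomorphism $J\to\mathbb{C}^\times$. For a closed subgroup $L\subseteq J$ and $(\rho,W)$ in $\mathrm{Alg}(L)$, $\mathrm{ind}_L^J(\rho)$ is the right translation action of $J$ on the space of functions $f:J\to W$ that satisfy $f(lg)=\rho(l)f(g)$ for $l\in L$, $g\in J$, are right invariant under some compact open subgroup of $J$, and are supported in $LC$ for some compact $C\subseteq J$. If $U\subseteq J$ is a closed subgroup, $\theta$ a character of $U$, and $(\pi,V)\in\mathrm{Alg}(J)$, then $\pi_{U,\theta}$ is the quotient $V/\langle \pi(u)v-\theta(u)v : u\in U, v\in V\rangle$, with the induced action of any subgroup of $J$ that normalizes $U$ and $\theta$ (that is, of elements $g$ with $gug^{-1}\in U$ and $\theta(gug^{-1})=\theta(u)$ for all $u\in U$). **Proposition.** Let $G_0$ be an $\ell$-group, let $G,H,U,U_0$ be closed subgroups of $G_0$ with $H\subseteq G$ and $U_0\subseteq U$,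 and suppose that $U$ is the union of its compact open subgroups. Let $\theta:U\to\mathbb{C}^\times$ be a character, and put $\theta_0=\theta|_{U_0}$. Assume that $G$ normalizes $U$ and $\theta$, that $G\cap U=\{e\}$, that $H$ normalizes $U_0$ and $\theta_0$, and that $GU$ and $HU_0$ are closed in $G_0$. Assume also that $GU$ is the topological semidirect product $G\ltimes U$, i.e. that the bijection $G\times U\to GU$, $(g,u)\mapsto gu$, is a homeomorphism (this is automatic if $GU$ is $\sigma$-compact). Then the following hold. 1. There is a unique homomorphism $m:H\to\mathbb{C}^\times$, the module of the action $h\cdot U_0u=U_0huh^{-1}$ of $H$ on $U_0\backslash U$, such that $I\big(x\mapsto \varphi(h^{-1}\cdot x)\big)=m(h)\,I(\varphi)$ for all $h\in H$, all locally constant compactly supported functions $\varphi:U_0\backslash U\to\mathbb{C}$, and all linear functionals $I$ on the space of such functions that are invariant under right translation by $U$. Its inverse $\delta=m^{-1}$ is a smooth character of $H$. 2. For every $(\tau,W)\in\mathrm{Alg}(HU_0)$ there is an isomorphism of $G$-modules $$\big(\mathrm{ind}_{HU_0}^{GU}(\tau)\big)_{U,\theta}\;\cong\;\mathrm{ind}_H^G\big(\tau_{U_0,\theta_0}\otimes\delta^{-1}\big).$$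 -/

import Mathlib

open Topology

noncomputable section

namespace TwistedJacquet

/-- An `ℓ`-group: a locally compact Hausdorff topological group in which the compact open
subgroups form a fundamental system of neighbourhoods of the identity. -/
class IsLGroup (G : Type*) [Group G] [TopologicalSpace G] : Prop
    extends IsTopologicalGroup G, LocallyCompactSpace G, T2Space G where
  exists_compact_open : ∀ N ∈ 𝓝 (1 : G),
    ∃ K : Subgroup G, IsOpen (K : Set G) ∧ IsCompact (K : Set G) ∧ (K : Set G) ⊆ N

/-- A topological group is the union of its compact open subgroups. -/
def IsUnionOfCompactOpen (U : Type*) [Group U] [TopologicalSpace U] : Prop :=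
  ∀ u : U, ∃ K : Subgroup U, IsOpen (K : Set U) ∧ IsCompact (K : Set U) ∧ u ∈ K

/-- Smoothness of a complex representation: the stabilizer of every vector is open. -/
def IsSmoothRep {L W : Type*} [Group L] [TopologicalSpace L] [AddCommGroup W] [Module ℂ W]
    (ρ : Representation ℂ L W) : Prop :=
  ∀ w : W, IsOpen {l : L | ρ l w = w}

/-- A homomorphism to `ℂˣ` is a smooth character: its kernel is open. -/
def IsSmoothChar {L : Type*} [Group L] [TopologicalSpace L] (χ : L →* ℂˣ) : Prop :=
  IsOpen (χ.ker : Set L)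

/-- The representation `ρ ⊗ χ` on the space of `ρ`. -/
def twist {L W : Type*} [Group L] [AddCommGroup W] [Module ℂ W]
    (ρ : Representation ℂ L W) (χ : L →* ℂˣ) : Representation ℂ L W where
  toFun l := (χ l : ℂ) • ρ l
  map_one' := by simp
  map_mul' a b := by
    ext w
    simp only [map_mul, Units.val_mul, LinearMap.smul_apply, Module.End.mul_apply, map_smul,
      mul_smul]
    exact smul_comm _ _ _

variable {G₀ : Type*} [Group G₀]

/-! ### Unnormalized compact induction -/

section Induction

variable [TopologicalSpace G₀] [IsTopologicalGroup G₀]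
  {L J : Subgroup G₀} {W : Type*} [AddCommGroup W] [Module ℂ W]

/-- The space `ind_L^J(W)` of functions `f : J → W` with `f (l g) = ρ(l) (f g)`, invariant under
right translation by some open subgroup, and with support contained in `L C` for some
compact `C ⊆ J`. (In an `ℓ`-group every open subgroup contains a compact open one.) -/
def cIndSpace (hLJ : L ≤ J) (ρ : Representation ℂ L W) : Submodule ℂ (J → W) where
  carrier := {f |
    (∃ K : OpenSubgroup J, ∀ k ∈ K, ∀ g : J, f (g * k) = f g) ∧
    (∀ (l : L) (g : J), f (Subgroup.inclusion hLJ l * g) = ρ l (f g)) ∧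
    ∃ C : Set J, IsCompact C ∧
      ∀ g : J, f g ≠ 0 → ∃ l : L, ∃ c ∈ C, g = Subgroup.inclusion hLJ l * c}
  zero_mem' := ⟨⟨⊤, fun _ _ _ => rfl⟩, fun l g => by simp,
    ∅, isCompact_empty, fun g hg => absurd rfl hg⟩
  add_mem' := by
    rintro f₁ f₂ ⟨⟨K₁, hK₁⟩, h₁, C₁, hC₁, hs₁⟩ ⟨⟨K₂, hK₂⟩, h₂, C₂, hC₂, hs₂⟩
    refine ⟨⟨K₁ ⊓ K₂, fun k hk g => ?_⟩, fun l g => ?_, C₁ ∪ C₂, hC₁.union hC₂, fun g hg => ?_⟩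
    · obtain ⟨hk₁, hk₂⟩ := OpenSubgroup.mem_inf.1 hk
      simp [hK₁ k hk₁ g, hK₂ k hk₂ g]
    · simp [h₁, h₂]
    · by_cases h : f₁ g = 0
      · have h' : f₂ g ≠ 0 := fun h0 => hg (by simp [h, h0])
        obtain ⟨l, c, hc, e⟩ := hs₂ g h'
        exact ⟨l, c, Or.inr hc, e⟩
      · obtain ⟨l, c, hc, e⟩ := hs₁ g h
        exact ⟨l, c, Or.inl hc, e⟩
  smul_mem' := by
    rintro a f ⟨⟨K, hK⟩, h, C, hC, hs⟩
    refine ⟨⟨K, fun k hk g => ?_⟩, fun l g => ?_, C, hC, fun g hg => hs g fun h0 => hg ?_⟩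
    · simp [hK k hk g]
    · simp [h]
    · simp [h0]

/-- The representation `ind_L^J(ρ)` of `J` on `ind_L^J(W)` by right translation. -/
def cInd (hLJ : L ≤ J) (ρ : Representation ℂ L W) : Representation ℂ J (cIndSpace hLJ ρ) where
  toFun x :=
    { toFun := fun f => ⟨fun g => f.1 (g * x), by
        obtain ⟨f, ⟨K, hK⟩, h, C, hC, hs⟩ := f
        refine ⟨⟨K.comap (MulAut.conj x⁻¹).toMonoidHom ?_, fun k hk g => ?_⟩,
          fun l g => ?_, (fun c => c * x⁻¹) '' C, hC.image (continuous_mul_const _),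
          fun g hg => ?_⟩
        · change Continuous fun y : J => x⁻¹ * y * x⁻¹⁻¹
          fun_prop
        · have hk' : x⁻¹ * k * x⁻¹⁻¹ ∈ K := hk
          have := hK _ hk' (g * x)
          simpa [mul_assoc] using this
        · simpa [mul_assoc] using h l (g * x)
        · obtain ⟨l, c, hc, e⟩ := hs _ hg
          exact ⟨l, c * x⁻¹, ⟨c, hc, rfl⟩, by rw [← mul_assoc, ← e]; simp⟩⟩
      map_add' := fun _ _ => rfl
      map_smul' := fun _ _ => rfl }
  map_one' := by
    ext f g
    simp
  map_mul' x y := by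
    ext f g
    simp [mul_assoc]

end Induction

/-! ### Twisted Jacquet modules -/

section Jacquet

/-- The set of `g` with `g u g⁻¹ ∈ U` and `θ (g u g⁻¹) = θ u` for all `u ∈ U`. -/
def charNormalizer (U : Subgroup G₀) (θ : U →* ℂˣ) : Set G₀ :=
  {g | ∀ u : U, ∃ hu : g * u * g⁻¹ ∈ U, θ ⟨g * u * g⁻¹, hu⟩ = θ u}

/-- A subgroup all of whose elements conjugate `U` into `U` normalizes `U`. -/
theorem mem_iff_conj_mem {H U : Subgroup G₀} {θ : U →* ℂˣ}
    (hH : (H : Set G₀) ⊆ charNormalizer U θ) (h : H) (u : G₀) :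
    u ∈ U ↔ (h : G₀) * u * (h : G₀)⁻¹ ∈ U := by
  refine ⟨fun hu => (hH h.2 ⟨u, hu⟩).1, fun hu => ?_⟩
  have := (hH (H.inv_mem h.2) ⟨_, hu⟩).1
  simpa [mul_assoc] using this

variable {J U L : Subgroup G₀} {V : Type*} [AddCommGroup V] [Module ℂ V]

/-- The subspace `V(U, θ)` spanned by the vectors `π(u) v - θ(u) v`. -/
def jacquetKer (hUJ : U ≤ J) (θ : U →* ℂˣ) (π : Representation ℂ J V) : Submodule ℂ V :=
  Submodule.span ℂ
    {x | ∃ (u : U) (v : V), x = π (Subgroup.inclusion hUJ u) v - (θ u : ℂ) • v}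

/-- The twisted Jacquet module `π_{U,θ}`: the action on `V ⧸ V(U, θ)` of a subgroup `L` that
normalizes `U` and `θ`. -/
def jacquet (hUJ : U ≤ J) (hLJ : L ≤ J) (θ : U →* ℂˣ) (hL : (L : Set G₀) ⊆ charNormalizer U θ)
    (π : Representation ℂ J V) : Representation ℂ L (V ⧸ jacquetKer hUJ θ π) :=
  Representation.quotient (π.comp (Subgroup.inclusion hLJ)) (jacquetKer hUJ θ π) (by
    intro l
    refine Submodule.span_le.2 ?_
    rintro _ ⟨u, v, rfl⟩
    obtain ⟨hu, hθ⟩ := hL l.2 u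
    refine Submodule.subset_span
      ⟨⟨l * u * (l : G₀)⁻¹, hu⟩, π (Subgroup.inclusion hLJ l) v, ?_⟩
    rw [hθ, ← Module.End.mul_apply, ← map_mul]
    have : Subgroup.inclusion hUJ ⟨l * u * (l : G₀)⁻¹, hu⟩ * Subgroup.inclusion hLJ l =
        Subgroup.inclusion hLJ l * Subgroup.inclusion hUJ u := by
      ext
      simp
    rw [this, map_mul, Module.End.mul_apply]
    simp)

end Jacquet

/-! ### The module of the action by conjugation on `U₀ \ U` -/

section Module

variable [TopologicalSpace G₀] [IsTopologicalGroup G₀] {U₀ U : Subgroup G₀}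

/-- The locally constant compactly supported functions on `U₀ \ U`, viewed as left
`U₀`-invariant locally constant functions on `U` with support in `U₀ C`, `C` compact. -/
def quotSchwartz (hU : U₀ ≤ U) : Submodule ℂ (U → ℂ) where
  carrier := {φ |
    IsLocallyConstant φ ∧
    (∀ (u₀ : U₀) (u : U), φ (Subgroup.inclusion hU u₀ * u) = φ u) ∧
    ∃ C : Set U, IsCompact C ∧
      ∀ u : U, φ u ≠ 0 → ∃ u₀ : U₀, ∃ c ∈ C, u = Subgroup.inclusion hU u₀ * c}
  zero_mem' := ⟨IsLocallyConstant.const 0, fun _ _ => rfl,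
    ∅, isCompact_empty, fun u hu => absurd rfl hu⟩
  add_mem' := by
    rintro f₁ f₂ ⟨hl₁, h₁, C₁, hC₁, hs₁⟩ ⟨hl₂, h₂, C₂, hC₂, hs₂⟩
    refine ⟨hl₁.add hl₂, fun l g => ?_, C₁ ∪ C₂, hC₁.union hC₂, fun g hg => ?_⟩
    · simp [h₁, h₂]
    · by_cases h : f₁ g = 0
      · have h' : f₂ g ≠ 0 := fun h0 => hg (by simp [h, h0])
        obtain ⟨l, c, hc, e⟩ := hs₂ g h'
        exact ⟨l, c, Or.inr hc, e⟩
      · obtain ⟨l, c, hc, e⟩ := hs₁ g h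
        exact ⟨l, c, Or.inl hc, e⟩
  smul_mem' := by
    rintro a f ⟨hl, h, C, hC, hs⟩
    refine ⟨hl.comp (fun z => a • z), fun l g => ?_, C, hC,
      fun g hg => hs g fun h0 => hg ?_⟩
    · simp [h]
    · simp [h0]

/-- Right translation by `x ∈ U`: `φ ↦ (u ↦ φ (u x))`. -/
def quotTranslate (hU : U₀ ≤ U) (x : U) (φ : quotSchwartz hU) : quotSchwartz hU :=
  ⟨fun u => φ.1 (u * x), by
    obtain ⟨φ, hl, h, C, hC, hs⟩ := φ
    refine ⟨hl.comp_continuous (continuous_mul_const x), fun l g => ?_,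
      (fun c => c * x⁻¹) '' C, hC.image (continuous_mul_const _), fun g hg => ?_⟩
    · simpa [mul_assoc] using h l (g * x)
    · obtain ⟨l, c, hc, e⟩ := hs _ hg
      exact ⟨l, c * x⁻¹, ⟨c, hc, rfl⟩, by rw [← mul_assoc, ← e]; simp⟩⟩

/-- For `h` normalizing `U` and `U₀`, with `σ(U₀ u) = U₀ h u h⁻¹` the induced automorphism of
`U₀ \ U`, the operator `φ ↦ φ ∘ σ⁻¹`, that is `φ ↦ (u ↦ φ (h⁻¹ u h))`. -/
def quotConj (hU : U₀ ≤ U) (h : G₀) (hN : ∀ u, u ∈ U ↔ h * u * h⁻¹ ∈ U)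
    (hN₀ : ∀ u, u ∈ U₀ ↔ h * u * h⁻¹ ∈ U₀) (φ : quotSchwartz hU) : quotSchwartz hU :=
  ⟨fun u => φ.1 ⟨h⁻¹ * u * h, (hN _).2 (by simp [mul_assoc])⟩, by
    obtain ⟨φ, hl, hi, C, hC, hs⟩ := φ
    refine ⟨hl.comp_continuous (by fun_prop), fun l g => ?_,
      (fun c : U => (⟨h * c * h⁻¹, (hN _).1 c.2⟩ : U)) '' C,
      hC.image (by fun_prop), fun g hg => ?_⟩
    · have := hi ⟨h⁻¹ * l * h, (hN₀ _).2 (by simp [mul_assoc])⟩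
        ⟨h⁻¹ * g * h, (hN _).2 (by simp [mul_assoc])⟩
      refine (congrArg φ (Subtype.ext ?_)).trans this
      simp [mul_assoc]
    · obtain ⟨l, c, hc, e⟩ := hs _ hg
      refine ⟨⟨h * l * h⁻¹, (hN₀ _).1 l.2⟩, _, ⟨c, hc, rfl⟩, Subtype.ext ?_⟩
      have e' : h⁻¹ * (g : G₀) * h = l * c := congrArg Subtype.val e
      have e'' : (g : G₀) = h * (l * c) * h⁻¹ := by
        rw [← e']
        group
      rw [e'']
      simp [mul_assoc]⟩

/-- `m` is the module of the action `h · U₀ u = U₀ h u h⁻¹` of `H` on `U₀ \ U`: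
`I (φ ∘ σ_h⁻¹) = m(h) I(φ)` for every linear functional `I` on the locally constant compactly
supported functions on `U₀ \ U` that is invariant under right translation by `U`. -/
def IsQuotModule (hU : U₀ ≤ U) (H : Subgroup G₀)
    (hN : ∀ (h : H) (u : G₀), u ∈ U ↔ (h : G₀) * u * (h : G₀)⁻¹ ∈ U)
    (hN₀ : ∀ (h : H) (u : G₀), u ∈ U₀ ↔ (h : G₀) * u * (h : G₀)⁻¹ ∈ U₀)
    (m : H →* ℂˣ) : Prop :=
  ∀ I : quotSchwartz hU →ₗ[ℂ] ℂ,
    (∀ (x : U) (φ : quotSchwartz hU), I (quotTranslate hU x φ) = I φ) →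
    ∀ (h : H) (φ : quotSchwartz hU), I (quotConj hU h (hN h) (hN₀ h) φ) = (m h : ℂ) * I φ

end Module

end TwistedJacquet

end

open TwistedJacquet

open Topology

noncomputable section

namespace TwistedJacquet

set_option linter.unusedSectionVars false

/-! The isomorphism is a fibrewise integral. Let `q` be the projection of `W` onto the `(U₀,
θ₀)`-coinvariants. For `f` in the induced space of `GU` put `Φ(f)(g) = ∫ θ(u)⁻¹ q(f(u g)) du`, the
integral being over `U₀ \ U` (`fiberMap`). Twisted translates under `U` are killed, and `G` acts by
right translation in `g`. Since `f(u h g) = τ(h) f(h⁻¹ u h · g)`, the substitution `u ↦ h u h⁻¹`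
makes `Φ(f)` equivariant under `H` with the extra factor `m(h) = δ(h)⁻¹` (`fiberMap_mul_left`).

The case `G = H = 1` is the core (`exists_twistedIntegral`): the integral identifies the `(U,
θ)`-coinvariants of the space induced from `U₀` to `U` with the `(U₀, θ₀)`-coinvariants of `W`.
Every function is congruent, modulo twisted translates, to one `bump` function supported on `U₀ K`
with value `w` at `1`, where `K` may be any sufficiently small compact open subgroup. Its integral
is a nonzero multiple of `q(w)`. If `q(w) = 0`, the `bump` function is itself a combination of
twisted translates (`bump_mem_funKer`), because every element of `U` normalizes arbitrarily small
compact open subgroups. Applied to the trivial representation, this also gives uniqueness of the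
invariant functional on `U₀ \ U`, hence the module `m`. Existence comes from Haar measures on `U`
and `U₀`, which are unimodular as unions of compact open subgroups.

The general case reduces to this one by localizing over `H \ G`. Restriction to `U` is surjective
onto the space induced from `U₀` to `U` (`resU_surjective`), and indicators of left `H`-invariant
clopen subsets of `G`, pulled back to `GU`, commute with everything in sight. Compactness of
supports modulo `H` then gives injectivity (`mem_jacquetKer_of_fiberMap_eq_zero`) and surjectivity
(`exists_fiberMap_eq`). -/

/-! ### Compact open subgroups -/

section Groups

/-- A closed subgroup of an `ℓ`-group is an `ℓ`-group. -/
theorem IsLGroup.of_isClosed {G₀ : Type*} [Group G₀] [TopologicalSpace G₀] [IsLGroup G₀]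
    {J : Subgroup G₀} (hJ : IsClosed (J : Set G₀)) : IsLGroup J where
  toLocallyCompactSpace := hJ.locallyCompactSpace
  exists_compact_open N hN := by
    obtain ⟨N', hN', hsub⟩ := mem_nhds_subtype _ _ _ |>.1 hN
    obtain ⟨K, hKo, hKc, hKN⟩ := IsLGroup.exists_compact_open N' hN'
    exact ⟨K.subgroupOf J, hKo.preimage continuous_subtype_val,
      hJ.isClosedEmbedding_subtypeVal.isCompact_preimage hKc, fun x hx => hsub (hKN hx)⟩

variable {J : Type*} [Group J] [TopologicalSpace J] [IsLGroup J]

/-- An element of a compact subgroup normalizes arbitrarily small compact open subgroups. -/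
theorem exists_compact_open_conj {K : Subgroup J} (hKo : IsOpen (K : Set J))
    (hKc : IsCompact (K : Set J)) {u : J} (hu : u ∈ K) {N : Set J} (hN : N ∈ 𝓝 (1 : J)) :
    ∃ K' : Subgroup J, IsOpen (K' : Set J) ∧ IsCompact (K' : Set J) ∧ (K' : Set J) ⊆ N ∧
      ∀ k ∈ K', u⁻¹ * k * u ∈ K' ∧ u * k * u⁻¹ ∈ K' := by
  obtain ⟨T, hTo, hTc, hTN⟩ := IsLGroup.exists_compact_open N hN
  have : CompactSpace K := isCompact_iff_compactSpace.1 hKc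
  have hcl : IsClopen ((↑) ⁻¹' (T : Set J) : Set K) :=
    IsClopen.preimage ⟨Subgroup.isClosed_of_isOpen _ hTo, hTo⟩ continuous_subtype_val
  -- Inside the compact group `K` the clopen neighbourhood `T ∩ K` contains an open normal subgroup,
  -- and normality in `K` gives stability under conjugation by `u`.
  obtain ⟨M, hM⟩ := IsTopologicalGroup.exist_openNormalSubgroup_sub_clopen_nhds_of_one hcl
    (show ((1 : K) : J) ∈ T from T.one_mem)
  refine ⟨M.toSubgroup.map K.subtype, ?_, ?_, ?_, ?_⟩
  · exact hKo.isOpenEmbedding_subtypeVal.isOpenMap _ M.isOpen'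
  · exact (M.toOpenSubgroup.isClosed.isCompact).image continuous_subtype_val
  · rintro _ ⟨x, hx, rfl⟩
    exact hTN (hM hx)
  · rintro _ ⟨x, hx, rfl⟩
    refine ⟨⟨(⟨u, hu⟩ : K)⁻¹ * x * ⟨u, hu⟩, ?_, by simp⟩,
      ⟨⟨u, hu⟩ * x * (⟨u, hu⟩ : K)⁻¹, M.isNormal'.conj_mem x hx _, by simp⟩⟩
    simpa using M.isNormal'.conj_mem x hx (⟨u, hu⟩ : K)⁻¹

/-- A subset which is stable under right translation by an open subgroup is clopen. -/
theorem isClopen_of_mul_mem {J : Type*} [Group J] [TopologicalSpace J] [IsTopologicalGroup J]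
    (K : OpenSubgroup J) {A : Set J} (hA : ∀ a ∈ A, ∀ k ∈ K, a * k ∈ A) : IsClopen A := by
  have key : ∀ B : Set J, (∀ a ∈ B, ∀ k ∈ K, a * k ∈ B) → IsOpen B := fun B hB => by
    rw [isOpen_iff_mem_nhds]
    intro b hb
    have hc : ContinuousAt (fun x => b⁻¹ * x) b := by fun_prop
    have : (fun x => b⁻¹ * x) ⁻¹' (K : Set J) ∈ 𝓝 b :=
      hc.preimage_mem_nhds (by simpa using K.mem_nhds_one)
    filter_upwards [this] with x hx
    simpa using hB b hb _ hx
  refine ⟨⟨key _ fun a ha k hk hak => ha ?_⟩, key A hA⟩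
  simpa using hA _ hak _ (K.inv_mem hk)

/-- The double coset `H g K` of an open subgroup `K` is clopen. -/
theorem isClopen_doubleCoset {J : Type*} [Group J] [TopologicalSpace J] [IsTopologicalGroup J]
    (H : Subgroup J) (g : J) (K : OpenSubgroup J) :
    IsClopen {x : J | ∃ h ∈ H, ∃ k ∈ K, x = h * g * k} := by
  refine isClopen_of_mul_mem K ?_
  rintro _ ⟨h, hh, k, hk, rfl⟩ k' hk'
  exact ⟨h, hh, k * k', K.mul_mem hk hk', by simp [mul_assoc]⟩

/-- A submodule of functions that is stable under multiplication by the indicators of left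
`H`-invariant clopen sets contains a function as soon as it contains it locally, if the function
is supported in `H C` for a compact `C`. -/
theorem mem_of_locally_mem {Y : Type*} [Group Y] [TopologicalSpace Y]
    {X W : Type*} [AddCommGroup W] [Module ℂ W] (H : Subgroup Y) (p : X → Y)
    (S : Submodule ℂ (X → W))
    (hS : ∀ A : Set Y, IsClopen A → (∀ h ∈ H, ∀ a, h * a ∈ A ↔ a ∈ A) →
      ∀ f ∈ S, (p ⁻¹' A).indicator f ∈ S)
    {f : X → W} {C : Set Y} (hC : IsCompact C)
    (hf : ∀ x, f x ≠ 0 → ∃ h ∈ H, ∃ c ∈ C, p x = h * c)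
    (hloc : ∀ y, ∃ A : Set Y, IsClopen A ∧ (∀ h ∈ H, ∀ a, h * a ∈ A ↔ a ∈ A) ∧ y ∈ A ∧
      (p ⁻¹' A).indicator f ∈ S) : f ∈ S := by
  -- The admissible clopen sets are stable under finite unions by inclusion-exclusion, so
  -- compactness yields one that contains `C`; being `H`-invariant, it contains the whole support.
  obtain ⟨A, hA, hinv, hCA, hfA⟩ : ∃ A : Set Y, IsClopen A ∧
      (∀ h ∈ H, ∀ a, h * a ∈ A ↔ a ∈ A) ∧ C ⊆ A ∧ (p ⁻¹' A).indicator f ∈ S := by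
    refine hC.induction_on (p := fun s => ∃ A : Set Y, IsClopen A ∧
      (∀ h ∈ H, ∀ a, h * a ∈ A ↔ a ∈ A) ∧ s ⊆ A ∧ (p ⁻¹' A).indicator f ∈ S) ?_ ?_ ?_ ?_
    · exact ⟨∅, isClopen_empty, by simp, subset_rfl, by
        rw [Set.preimage_empty, Set.indicator_empty]; exact S.zero_mem⟩
    · rintro s t hst ⟨A, h1, h2, h3, h4⟩
      exact ⟨A, h1, h2, hst.trans h3, h4⟩
    · rintro s t ⟨A, h1, h2, h3, h4⟩ ⟨B, k1, k2, k3, k4⟩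
      refine ⟨A ∪ B, h1.union k1, fun h hh a => by simp [h2 h hh, k2 h hh],
        Set.union_subset_union h3 k3, ?_⟩
      have : (p ⁻¹' (A ∪ B)).indicator f = (p ⁻¹' A).indicator f + (p ⁻¹' B).indicator f -
          (p ⁻¹' A).indicator ((p ⁻¹' B).indicator f) := by
        ext x
        by_cases ha : p x ∈ A <;> by_cases hb : p x ∈ B <;> simp [Set.indicator, ha, hb]
      rw [this]
      exact S.sub_mem (S.add_mem h4 k4) (hS A h1 h2 _ k4)
    · intro y _
      obtain ⟨A, h1, h2, h3, h4⟩ := hloc y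
      exact ⟨A, mem_nhdsWithin_of_mem_nhds (h1.isOpen.mem_nhds h3), A, h1, h2, subset_rfl, h4⟩
  have : (p ⁻¹' A).indicator f = f := by
    refine Set.indicator_eq_self.2 fun x hx => ?_
    obtain ⟨h, hh, c, hc, e⟩ := hf x hx
    change p x ∈ A
    rw [e, hinv h hh]
    exact hCA hc
  rwa [this] at hfA

end Groups

/-! ### Functions in compactly induced representations -/

section Induced

variable {G₀ : Type*} [Group G₀] [TopologicalSpace G₀] [IsTopologicalGroup G₀]
  {L J : Subgroup G₀} {W : Type*} [AddCommGroup W] [Module ℂ W]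
  {hLJ : L ≤ J} {ρ : Representation ℂ L W}

/-- A function that is right invariant under an open subgroup is locally constant. -/
theorem isLocallyConstant_of_right_invariant {J X : Type*} [Group J] [TopologicalSpace J]
    [IsTopologicalGroup J] {f : J → X} (K : OpenSubgroup J)
    (hK : ∀ k ∈ K, ∀ g, f (g * k) = f g) : IsLocallyConstant f := fun s =>
  (isClopen_of_mul_mem K fun a ha k hk => by simpa [hK k hk] using ha).isOpen

theorem isLocallyConstant_of_mem_cIndSpace {f : J → W} (hf : f ∈ cIndSpace hLJ ρ) :
    IsLocallyConstant f := by
  obtain ⟨⟨K, hK⟩, -⟩ := hf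
  exact isLocallyConstant_of_right_invariant K hK

/-- A locally constant equivariant function with compact support modulo `L` is right invariant
under an open subgroup. -/
theorem mem_cIndSpace_of_isLocallyConstant [IsLGroup J] {f : J → W} (hf : IsLocallyConstant f)
    (heq : ∀ (l : L) (g : J), f (Subgroup.inclusion hLJ l * g) = ρ l (f g))
    {C : Set J} (hC : IsCompact C)
    (hs : ∀ g : J, f g ≠ 0 → ∃ l : L, ∃ c ∈ C, g = Subgroup.inclusion hLJ l * c) :
    f ∈ cIndSpace hLJ ρ := by
  refine ⟨?_, heq, C, hC, hs⟩
  -- Compactness gives one `K` for all points of `C`; left equivariance then carries the invariance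
  -- to `L C`.
  obtain ⟨K, hK⟩ : ∃ K : OpenSubgroup J, ∀ c ∈ C, ∀ k ∈ K, f (c * k) = f c := by
    refine hC.induction_on (p := fun s => ∃ K : OpenSubgroup J, ∀ c ∈ s, ∀ k ∈ K,
      f (c * k) = f c) ⟨⊤, by simp⟩ ?_ ?_ ?_
    · rintro s t hst ⟨K, hK⟩
      exact ⟨K, fun c hc => hK c (hst hc)⟩
    · rintro s t ⟨K, hK⟩ ⟨K', hK'⟩
      refine ⟨K ⊓ K', fun c hc k hk => ?_⟩
      obtain ⟨h1, h2⟩ := OpenSubgroup.mem_inf.1 hk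
      exact hc.elim (fun h => hK c h k h1) (fun h => hK' c h k h2)
    · intro x _
      have hx : (fun k => x * k) ⁻¹' (f ⁻¹' {f x}) ∈ 𝓝 (1 : J) :=
        ((hf.isOpen_fiber (f x)).preimage (continuous_const_mul x)).mem_nhds (by simp)
      obtain ⟨K, hKo, -, hK⟩ := IsLGroup.exists_compact_open _ hx
      have hc : (fun y => x⁻¹ * y) ⁻¹' (K : Set J) ∈ 𝓝 x :=
        (hKo.preimage (continuous_const_mul x⁻¹)).mem_nhds (by simp [K.one_mem])
      refine ⟨_, mem_nhdsWithin_of_mem_nhds hc, ⟨K, hKo⟩, fun c hc k hk => ?_⟩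
      have h1 : f (x * (x⁻¹ * c)) = f x := hK hc
      have h2 : f (x * (x⁻¹ * c * k)) = f x := hK (K.mul_mem hc hk)
      rw [mul_inv_cancel_left] at h1
      rw [← mul_assoc, mul_inv_cancel_left] at h2
      rw [h1, h2]
  have key : ∀ k ∈ K, ∀ g, f g ≠ 0 → f (g * k) = f g := by
    intro k hk g hg
    obtain ⟨l, c, hc, rfl⟩ := hs g hg
    rw [mul_assoc, heq, heq, hK c hc k hk]
  refine ⟨K, fun k hk g => ?_⟩
  by_cases hg : f g = 0
  -- If `f (g * k) ≠ 0`, then `key` at `g * k` with `k⁻¹` shows that `f g` has the same nonzero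
  -- value.
  · by_contra hne
    have := key k⁻¹ (K.inv_mem hk) (g * k) (by rwa [hg] at hne)
    rw [mul_inv_cancel_right] at this
    exact hne this.symm
  · exact key k hk g hg

/-- Multiplication by the indicator of a left `L`-invariant clopen set. -/
theorem indicator_mem_cIndSpace [IsLGroup J] {f : J → W} (hf : f ∈ cIndSpace hLJ ρ) {A : Set J}
    (hA : IsClopen A) (hinv : ∀ (l : L) (a : J), Subgroup.inclusion hLJ l * a ∈ A ↔ a ∈ A) :
    A.indicator f ∈ cIndSpace hLJ ρ := by
  have hlc := isLocallyConstant_of_mem_cIndSpace hf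
  obtain ⟨-, heq, C, hC, hs⟩ := hf
  refine mem_cIndSpace_of_isLocallyConstant ?_ (fun l g => ?_) hC fun g hg => hs g fun h0 => hg ?_
  · refine (IsLocallyConstant.iff_eventually_eq _).2 fun x => ?_
    by_cases hx : x ∈ A
    · filter_upwards [hA.isOpen.mem_nhds hx, hlc.eventually_eq x] with y hy hy'
      simp [hx, hy, hy']
    · filter_upwards [hA.compl.isOpen.mem_nhds hx] with y hy
      simp [hx, show y ∉ A from hy]
  · by_cases hg : g ∈ A
    · simp [hg, (hinv l g).2 hg, heq]
    · simp [hg, mt (hinv l g).1 hg]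
  · by_cases h : g ∈ A <;> simp [h, h0]

end Induced

/-! ### Functions supported on `L K` -/

section Bump

/-- Compact open subgroups. -/
def IsCO {J : Type*} [Group J] [TopologicalSpace J] (K : Subgroup J) : Prop :=
  IsOpen (K : Set J) ∧ IsCompact (K : Set J)

theorem IsCO.of_le {J : Type*} [Group J] [TopologicalSpace J] [IsTopologicalGroup J]
    {K K' : Subgroup J} (hK : IsCO K) (hle : K' ≤ K) (hK' : IsOpen (K' : Set J)) : IsCO K' :=
  ⟨hK', hK.2.of_isClosed_subset (Subgroup.isClosed_of_isOpen _ hK') hle⟩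

theorem IsCO.inf {J : Type*} [Group J] [TopologicalSpace J] [IsTopologicalGroup J]
    {K K' : Subgroup J} (hK : IsCO K) (hK' : IsCO K') : IsCO (K ⊓ K') :=
  hK.of_le inf_le_left (hK.1.inter hK'.1)

theorem exists_isCO {J : Type*} [Group J] [TopologicalSpace J] [IsLGroup J] {N : Set J}
    (hN : N ∈ 𝓝 (1 : J)) : ∃ K : Subgroup J, IsCO K ∧ (K : Set J) ⊆ N := by
  obtain ⟨K, h1, h2, h3⟩ := IsLGroup.exists_compact_open N hN
  exact ⟨K, ⟨h1, h2⟩, h3⟩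

theorem IsCO.comap_conj {J : Type*} [Group J] [TopologicalSpace J] [IsTopologicalGroup J]
    {K : Subgroup J} (hK : IsCO K) (x : J) : IsCO (K.comap (MulAut.conj x⁻¹).toMonoidHom) := by
  have h : ((K.comap (MulAut.conj x⁻¹).toMonoidHom : Subgroup J) : Set J) =
      ((Homeomorph.mulLeft x⁻¹).trans (Homeomorph.mulRight x⁻¹⁻¹)) ⁻¹' (K : Set J) := rfl
  refine ⟨?_, ?_⟩
  · rw [h]
    exact hK.1.preimage (Homeomorph.continuous _)
  · rw [h]
    exact (Homeomorph.isCompact_preimage _).2 hK.2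

variable {G₀ : Type*} [Group G₀] {L J : Subgroup G₀} {W : Type*} [AddCommGroup W] [Module ℂ W]
  {hLJ : L ≤ J} {ρ : Representation ℂ L W}

/-- The vectors fixed by `L ∩ K`. -/
def fixedSpace (hLJ : L ≤ J) (ρ : Representation ℂ L W) (K : Subgroup J) : Submodule ℂ W where
  carrier := {w | ∀ l : L, Subgroup.inclusion hLJ l ∈ K → ρ l w = w}
  zero_mem' := by simp
  add_mem' h₁ h₂ l hl := by rw [map_add, h₁ l hl, h₂ l hl]
  smul_mem' a w h l hl := by rw [map_smul, h l hl]

theorem fixedSpace_anti {K K' : Subgroup J} (h : K' ≤ K) :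
    fixedSpace hLJ ρ K ≤ fixedSpace hLJ ρ K' := fun _ hw l hl => hw l (h hl)

open Classical in
/-- The function supported on `L K` with value `ρ(l) w` at `l k`. -/
def bump (hLJ : L ≤ J) (ρ : Representation ℂ L W) (K : Subgroup J) (w : W) : J → W := fun y =>
  if h : ∃ l : L, (Subgroup.inclusion hLJ l)⁻¹ * y ∈ K then ρ h.choose w else 0

/-- The choice of `l` is immaterial: two choices differ by an element of `L ∩ K`, which fixes `w`.
-/
theorem bump_of_mem {K : Subgroup J} {w : W} (hw : w ∈ fixedSpace hLJ ρ K) {l : L} {y : J}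
    (h : (Subgroup.inclusion hLJ l)⁻¹ * y ∈ K) : bump hLJ ρ K w y = ρ l w := by
  have hex : ∃ l : L, (Subgroup.inclusion hLJ l)⁻¹ * y ∈ K := ⟨l, h⟩
  rw [bump, dif_pos hex]
  have h2 := K.mul_mem h (K.inv_mem hex.choose_spec)
  have h3 : Subgroup.inclusion hLJ (l⁻¹ * hex.choose) ∈ K := by
    simpa [mul_assoc] using h2
  conv_rhs => rw [← hw _ h3, ← Module.End.mul_apply, ← map_mul, mul_inv_cancel_left]

theorem bump_mul {K : Subgroup J} {w : W} (hw : w ∈ fixedSpace hLJ ρ K) (l : L) {k : J}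
    (hk : k ∈ K) : bump hLJ ρ K w (Subgroup.inclusion hLJ l * k) = ρ l w :=
  bump_of_mem hw (by simpa)

theorem bump_of_not_mem {K : Subgroup J} {w : W} {y : J}
    (h : ¬ ∃ l : L, (Subgroup.inclusion hLJ l)⁻¹ * y ∈ K) : bump hLJ ρ K w y = 0 :=
  dif_neg h

theorem bump_add (K : Subgroup J) (w w' : W) :
    bump hLJ ρ K (w + w') = bump hLJ ρ K w + bump hLJ ρ K w' := by
  ext y
  by_cases h : ∃ l : L, (Subgroup.inclusion hLJ l)⁻¹ * y ∈ K <;> simp [bump, h]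

theorem bump_smul (K : Subgroup J) (a : ℂ) (w : W) :
    bump hLJ ρ K (a • w) = a • bump hLJ ρ K w := by
  ext y
  by_cases h : ∃ l : L, (Subgroup.inclusion hLJ l)⁻¹ * y ∈ K <;> simp [bump, h]

theorem bump_zero (K : Subgroup J) : bump hLJ ρ K (0 : W) = 0 := by
  simpa using bump_smul (hLJ := hLJ) (ρ := ρ) K 0 0

theorem bump_mul_right {K : Subgroup J} {w : W} (hw : w ∈ fixedSpace hLJ ρ K) (y : J) {k : J}
    (hk : k ∈ K) : bump hLJ ρ K w (y * k) = bump hLJ ρ K w y := by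
  by_cases h : ∃ l : L, (Subgroup.inclusion hLJ l)⁻¹ * y ∈ K
  · obtain ⟨l, hl⟩ := h
    rw [bump_of_mem hw hl, bump_of_mem hw (l := l)]
    rw [← mul_assoc]
    exact K.mul_mem hl hk
  · rw [bump_of_not_mem h, bump_of_not_mem]
    rintro ⟨l, hl⟩
    refine h ⟨l, ?_⟩
    rw [← mul_assoc] at hl
    simpa using K.mul_mem hl (K.inv_mem hk)

theorem bump_mul_left {K : Subgroup J} {w : W} (hw : w ∈ fixedSpace hLJ ρ K) (l : L) (y : J) :
    bump hLJ ρ K w (Subgroup.inclusion hLJ l * y) = ρ l (bump hLJ ρ K w y) := by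
  by_cases h : ∃ l : L, (Subgroup.inclusion hLJ l)⁻¹ * y ∈ K
  · obtain ⟨l', hl⟩ := h
    rw [bump_of_mem hw hl, bump_of_mem hw (l := l * l')]
    · simp
    · simpa [mul_assoc] using hl
  · rw [bump_of_not_mem h, bump_of_not_mem, map_zero]
    rintro ⟨l', hl⟩
    refine h ⟨l⁻¹ * l', ?_⟩
    simpa [mul_assoc] using hl

variable [TopologicalSpace G₀] [IsTopologicalGroup G₀]

theorem bump_mem_cIndSpace {K : Subgroup J} (hK : IsCO K) {w : W}
    (hw : w ∈ fixedSpace hLJ ρ K) : bump hLJ ρ K w ∈ cIndSpace hLJ ρ := by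
  refine ⟨⟨⟨K, hK.1⟩, fun k hk g => bump_mul_right hw g hk⟩, bump_mul_left hw, K, hK.2,
    fun g hg => ?_⟩
  by_contra hne
  refine hg (bump_of_not_mem fun ⟨l, hl⟩ => hne ⟨l, _, hl, by simp⟩)

/-- Every element of the induced space is a sum of translates of functions `bump`. -/
theorem cIndSpace_induction [IsLGroup J] {p : (J → W) → Prop} (zero : p 0)
    (add : ∀ F F', p F → p F' → p (F + F'))
    (bump : ∀ (K : Subgroup J) (w : W) (x : J), IsCO K → w ∈ fixedSpace hLJ ρ K →
      p (fun y => bump hLJ ρ K w (y * x))) {F : J → W} (hF : F ∈ cIndSpace hLJ ρ) : p F := by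
  classical
  obtain ⟨⟨K₁, hK₁⟩, heq, C, hC, hsC⟩ := hF
  obtain ⟨K, hK, hKK⟩ := exists_isCO K₁.mem_nhds_one
  replace hK₁ : ∀ k ∈ K, ∀ g, F (g * k) = F g := fun k hk => hK₁ k (hKK hk)
  obtain ⟨s, hs⟩ : ∃ s : Finset J, ∀ y, F y ≠ 0 → ∃ l : L, ∃ x ∈ s, ∃ k ∈ K,
      y = Subgroup.inclusion hLJ l * x * k := by
    obtain ⟨s, -, hCs⟩ := hC.elim_nhds_subcover (fun x => (fun y => x⁻¹ * y) ⁻¹' (K : Set J))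
      (fun x _ => (hK.1.preimage (continuous_const_mul x⁻¹)).mem_nhds (by simp [K.one_mem]))
    refine ⟨s, fun y hy => ?_⟩
    obtain ⟨l, c, hc, rfl⟩ := hsC y hy
    obtain ⟨x, hx, hxc⟩ := Set.mem_iUnion₂.1 (hCs hc)
    exact ⟨l, x, hx, _, hxc, by simp [mul_assoc]⟩
  clear hC hsC
  induction s using Finset.induction_on generalizing F with
  | empty =>
    have : F = 0 := by
      ext y
      by_contra hy
      obtain ⟨l, x, hx, -⟩ := hs y hy
      simp at hx
    rwa [this]
  | insert x s hxs ih =>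
    -- `K' = x K x⁻¹`, so the double coset `L x K` is the right translate `L K' x`. Subtracting the
    -- translated `bump` function `F₁` removes this double coset from the support.
    set K' := K.comap (MulAut.conj x⁻¹).toMonoidHom with hK'
    have hmem : ∀ y, y ∈ K' ↔ x⁻¹ * y * x ∈ K := fun y => by simp [hK', Subgroup.mem_comap]
    have hw : F x ∈ fixedSpace hLJ ρ K' := fun l hl => by
      rw [← heq, ← hK₁ _ ((hmem _).1 hl) x]
      simp [mul_assoc]
    set F₁ : J → W := fun y => TwistedJacquet.bump hLJ ρ K' (F x) (y * x⁻¹) with hF₁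
    have hin : ∀ (l : L) (k : J), k ∈ K → F (Subgroup.inclusion hLJ l * x * k) =
        F₁ (Subgroup.inclusion hLJ l * x * k) := fun l k hk => by
      have hk' : x * k * x⁻¹ ∈ K' := (hmem _).2 (by simpa [mul_assoc])
      rw [hF₁, hK₁ k hk, heq, ← bump_mul hw l hk']
      simp [mul_assoc]
    have hF₁K : ∀ k ∈ K, ∀ g, F₁ (g * k) = F₁ g := fun k hk g => by
      have hk' : x * k * x⁻¹ ∈ K' := (hmem _).2 (by simpa [mul_assoc])
      rw [hF₁]
      dsimp only
      rw [← bump_mul_right hw (g * x⁻¹) hk']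
      simp [mul_assoc]
    have hF₁L : ∀ (l : L) (g : J), F₁ (Subgroup.inclusion hLJ l * g) = ρ l (F₁ g) := fun l g => by
      rw [hF₁]
      dsimp only
      rw [mul_assoc, bump_mul_left hw]
    have hsum : F = F₁ + (F - F₁) := by abel
    rw [hsum]
    refine add _ _ (bump K' (F x) x⁻¹ (hK.comap_conj x) hw) (ih (F := F - F₁) ?_ ?_ ?_)
    · intro l g
      simp [heq, hF₁L]
    · intro k hk g
      simp [hK₁ k hk g, hF₁K k hk g]
    · intro y hy
      -- `F` and `F₁` agree on `L x K`, and `F₁` vanishes off it, so the subtraction creates no new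
      -- support.
      have hFy : F y ≠ 0 := fun h0 => hy <| by
        by_cases h : ∃ l : L, (Subgroup.inclusion hLJ l)⁻¹ * (y * x⁻¹) ∈ K'
        · obtain ⟨l, hl⟩ := h
          have hk := (hmem _).1 hl
          have := hin l _ hk
          simp only [mul_assoc, mul_inv_cancel_left, inv_mul_cancel, mul_one] at this
          simp [this]
        · simp [h0, hF₁, bump_of_not_mem h]
      obtain ⟨l, x', hx', k, hk, rfl⟩ := hs y hFy
      rcases Finset.mem_insert.1 hx' with rfl | hx'
      · exact absurd (by simp [hin l k hk]) hy
      · exact ⟨l, x', hx', k, hk, rfl⟩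

/-- A multiple of a function `bump` is a sum of translates of a function `bump` of a smaller
compact open subgroup. -/
theorem exists_smul_bump_eq_sum {K K' : Subgroup J} (hK : IsCO K) (hK' : IsCO K') (hle : K' ≤ K) :
    ∃ (s : Finset J) (n : ℕ), n ≠ 0 ∧ s.Nonempty ∧ (∀ x ∈ s, x ∈ K) ∧
      ∀ w ∈ fixedSpace hLJ ρ K, (n : ℂ) • bump hLJ ρ K w =
        ∑ x ∈ s, fun y => bump hLJ ρ K' w (y * x) := by
  classical
  have : CompactSpace K := isCompact_iff_compactSpace.1 hK.2
  let M : OpenSubgroup K := ⟨K'.subgroupOf K, hK'.1.preimage continuous_subtype_val⟩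
  have : Finite (K ⧸ M.toSubgroup) := Subgroup.quotient_finite_of_isOpen _ M.isOpen
  let _ : Fintype (K ⧸ M.toSubgroup) := Fintype.ofFinite _
  let r : K ⧸ M.toSubgroup → J := fun x => (x.out : K)
  have hr : Function.Injective r := fun x y h =>
    Quotient.out_injective (Subtype.ext h)
  let t := Finset.univ.filter fun x : K ⧸ M.toSubgroup =>
    ∃ l : L, (Subgroup.inclusion hLJ l)⁻¹ * r x ∈ K'
  -- Here `n` counts the cosets in `K / K'` that meet `L K'`. It is nonzero because of the trivial
  -- coset.
  refine ⟨Finset.univ.image r, t.card, ?_, ⟨r (QuotientGroup.mk 1), by simp⟩, ?_, fun w hw => ?_⟩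
  · refine Finset.card_ne_zero_of_mem (a := QuotientGroup.mk 1) ?_
    simp only [t, Finset.mem_filter, Finset.mem_univ, true_and]
    refine ⟨1, ?_⟩
    have : (QuotientGroup.mk 1 : K ⧸ M.toSubgroup).out ∈ M.toSubgroup := by
      have := (QuotientGroup.eq (s := M.toSubgroup) (a := 1)
        (b := (QuotientGroup.mk 1 : K ⧸ M.toSubgroup).out)).1 (by simp)
      simpa using this
    have h2 : r (QuotientGroup.mk 1) ∈ K' := this
    simpa using h2
  · intro x hx
    obtain ⟨y, -, rfl⟩ := Finset.mem_image.1 hx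
    exact (Quotient.out y).2
  · have hw' := fixedSpace_anti hle hw
    rw [Finset.sum_image (fun x _ y _ h => hr h)]
    -- Left multiplication by `k` permutes `K / K'`, so the sum of the translates takes at `k` the
    -- same value as at `1`, namely `n • w`.
    have htr : ∀ (k : K) (x : K ⧸ M.toSubgroup),
        bump hLJ ρ K' w (k * r x) = bump hLJ ρ K' w (r (k • x)) := by
      intro k x
      have h1 : ((k • x).out : K)⁻¹ * (k * x.out) ∈ M.toSubgroup := by
        refine QuotientGroup.eq.1 ?_
        rw [QuotientGroup.out_eq', ← smul_eq_mul k x.out, ← MulAction.Quotient.smul_coe,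
          QuotientGroup.out_eq']
      have h2 : (r (k • x))⁻¹ * (k * r x) ∈ K' := h1
      rw [← bump_mul_right hw' (r (k • x)) h2, mul_inv_cancel_left]
    have hone : ∑ x, bump hLJ ρ K' w (r x) = (t.card : ℂ) • w := by
      have : ∀ x, bump hLJ ρ K' w (r x) =
          if ∃ l : L, (Subgroup.inclusion hLJ l)⁻¹ * r x ∈ K' then w else 0 := by
        intro x
        split_ifs with h
        · obtain ⟨l, hl⟩ := h
          rw [bump_of_mem hw' hl]
          refine hw l ?_
          have hx : r x ∈ K := (x.out).2
          simpa using K.mul_mem hx (K.inv_mem (hle hl))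
        · exact bump_of_not_mem h
      simp_rw [this]
      rw [← Finset.sum_filter, Finset.sum_const, Nat.cast_smul_eq_nsmul]
    ext y
    simp only [Pi.smul_apply, Finset.sum_apply]
    by_cases h : ∃ l : L, (Subgroup.inclusion hLJ l)⁻¹ * y ∈ K
    · obtain ⟨l, hl⟩ := h
      obtain ⟨k, rfl⟩ : ∃ k : K, y = Subgroup.inclusion hLJ l * k := ⟨⟨_, hl⟩, by simp⟩
      rw [bump_mul hw l k.2]
      simp_rw [mul_assoc, bump_mul_left hw', htr]
      rw [← map_sum, Fintype.sum_bijective (fun x => k • x) (MulAction.bijective k) _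
        (fun x => bump hLJ ρ K' w (r x)) (fun _ => rfl), hone, map_smul]
    · rw [bump_of_not_mem h, smul_zero]
      refine (Finset.sum_eq_zero fun x _ => bump_of_not_mem ?_).symm
      rintro ⟨l, hl⟩
      refine h ⟨l, ?_⟩
      have hx : r x ∈ K := (x.out).2
      simpa [mul_assoc] using K.mul_mem (hle hl) (K.inv_mem hx)

end Bump

/-! ### Twisted coinvariants of an induced representation -/

section Coinvariants

variable {G₀ : Type*} [Group G₀] {L J : Subgroup G₀} {W : Type*} [AddCommGroup W] [Module ℂ W]
  {hLJ : L ≤ J} {ρ : Representation ℂ L W} {θ : J →* ℂˣ}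

/-- The span of the vectors `ρ(l) v - χ(l) v`. -/
def twistKer {L W : Type*} [Group L] [AddCommGroup W] [Module ℂ W]
    (ρ : Representation ℂ L W) (χ : L →* ℂˣ) : Submodule ℂ W :=
  Submodule.span ℂ {x | ∃ (l : L) (v : W), x = ρ l v - (χ l : ℂ) • v}

variable [TopologicalSpace G₀] [IsTopologicalGroup G₀]

/-- The span of the functions `F(· u) - θ(u) F`, where `F` is in the induced space. -/
def funKer (hLJ : L ≤ J) (ρ : Representation ℂ L W) (θ : J →* ℂˣ) : Submodule ℂ (J → W) :=
  Submodule.span ℂ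
    {x | ∃ (u : J) (F : J → W), F ∈ cIndSpace hLJ ρ ∧ x = (fun y => F (y * u)) - (θ u : ℂ) • F}

theorem sub_mem_funKer {F : J → W} (hF : F ∈ cIndSpace hLJ ρ) (u : J) :
    (fun y => F (y * u)) - (θ u : ℂ) • F ∈ funKer hLJ ρ θ :=
  Submodule.subset_span ⟨u, F, hF, rfl⟩

/-- Replacing each translate by `x` in `exists_smul_bump_eq_sum` with `θ x` times the function gives
`c = n⁻¹ ∑ θ(x)`. If `θ` is trivial on `K`, this is a number of cosets divided by `n`, hence
nonzero. -/
theorem exists_bump_sub_smul_mem {K K' : Subgroup J} (hK : IsCO K) (hK' : IsCO K') (hle : K' ≤ K) :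
    ∃ c : ℂ, ((∀ k ∈ K, θ k = 1) → c ≠ 0) ∧ ∀ w ∈ fixedSpace hLJ ρ K,
      bump hLJ ρ K w - c • bump hLJ ρ K' w ∈ funKer hLJ ρ θ := by
  obtain ⟨s, n, hn, hs, hsK, h⟩ := exists_smul_bump_eq_sum (hLJ := hLJ) (ρ := ρ) hK hK' hle
  have hn' : (n : ℂ) ≠ 0 := Nat.cast_ne_zero.2 hn
  refine ⟨(n : ℂ)⁻¹ * ∑ x ∈ s, (θ x : ℂ), fun hθ => ?_, fun w hw => ?_⟩
  · rw [Finset.sum_congr rfl fun x hx => by rw [hθ x (hsK x hx)]]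
    simp [hn, hs.ne_empty]
  · have e : bump hLJ ρ K w - ((n : ℂ)⁻¹ * ∑ x ∈ s, (θ x : ℂ)) • bump hLJ ρ K' w =
        (n : ℂ)⁻¹ • ∑ x ∈ s, ((fun y => bump hLJ ρ K' w (y * x)) -
          (θ x : ℂ) • bump hLJ ρ K' w) := by
      rw [Finset.sum_sub_distrib, ← h w hw, smul_sub, inv_smul_smul₀ hn', ← Finset.sum_smul,
        smul_smul]
    rw [e]
    exact Submodule.smul_mem _ _ (Submodule.sum_mem _ fun x _ =>
      sub_mem_funKer (bump_mem_cIndSpace hK' (fixedSpace_anti hle hw)) x)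

theorem isInducing_inclusion (hLJ : L ≤ J) : IsInducing (Subgroup.inclusion hLJ) :=
  IsInducing.of_comp (continuous_induced_rng.2 continuous_subtype_val) continuous_subtype_val
    IsInducing.subtypeVal

/-- A vector of a smooth representation is fixed by a neighbourhood of the identity. -/
theorem exists_nhds_fixed (hLJ : L ≤ J) (hρ : IsSmoothRep ρ) (w : W) :
    ∃ N ∈ 𝓝 (1 : J), ∀ l : L, Subgroup.inclusion hLJ l ∈ N → ρ l w = w := by
  have : {l : L | ρ l w = w} ∈ 𝓝 (1 : L) := (hρ w).mem_nhds (by simp)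
  rw [(isInducing_inclusion hLJ).nhds_eq_comap] at this
  obtain ⟨N, hN, hsub⟩ := this
  rw [map_one] at hN
  exact ⟨N, hN, fun l hl => hsub hl⟩

/-- Modulo the twisted translates, every function in the induced space is of the form `bump`, for
any sufficiently small compact open subgroup. -/
theorem exists_sub_bump_mem [IsLGroup J] {F : J → W} (hF : F ∈ cIndSpace hLJ ρ) :
    ∃ K₀ : Subgroup J, IsCO K₀ ∧ ∀ K ≤ K₀, IsCO K → ∃ w ∈ fixedSpace hLJ ρ K,
      F - bump hLJ ρ K w ∈ funKer hLJ ρ θ := by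
  refine cIndSpace_induction (p := fun F => ∃ K₀ : Subgroup J, IsCO K₀ ∧ ∀ K ≤ K₀, IsCO K →
    ∃ w ∈ fixedSpace hLJ ρ K, F - bump hLJ ρ K w ∈ funKer hLJ ρ θ) ?_ ?_ ?_ hF
  · obtain ⟨K₀, h, -⟩ := exists_isCO (J := J) Filter.univ_mem
    exact ⟨K₀, h, fun K _ _ => ⟨0, Submodule.zero_mem _, by simp [bump_zero]⟩⟩
  · rintro F F' ⟨K₁, h₁, H₁⟩ ⟨K₂, h₂, H₂⟩
    refine ⟨K₁ ⊓ K₂, h₁.inf h₂, fun K hK hKo => ?_⟩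
    obtain ⟨w₁, hw₁, k₁⟩ := H₁ K (hK.trans inf_le_left) hKo
    obtain ⟨w₂, hw₂, k₂⟩ := H₂ K (hK.trans inf_le_right) hKo
    refine ⟨w₁ + w₂, add_mem hw₁ hw₂, ?_⟩
    rw [bump_add, add_sub_add_comm]
    exact add_mem k₁ k₂
  · intro K₀ w x hK₀ hw
    refine ⟨K₀, hK₀, fun K hK hKo => ?_⟩
    obtain ⟨c, -, hc⟩ := exists_bump_sub_smul_mem (hLJ := hLJ) (ρ := ρ) (θ := θ) hK₀ hKo hK
    refine ⟨(θ x : ℂ) • c • w, Submodule.smul_mem _ _ (Submodule.smul_mem _ _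
      (fixedSpace_anti hK hw)), ?_⟩
    -- The translation by `x` costs the factor `θ x`, and shrinking the subgroup costs `c`.
    have := add_mem (sub_mem_funKer (θ := θ) (bump_mem_cIndSpace hK₀ hw) x)
      (Submodule.smul_mem _ (θ x : ℂ) (hc w hw))
    rw [smul_sub, sub_add_sub_cancel] at this
    rwa [bump_smul, bump_smul]

/-- If `w` is zero in the twisted coinvariants of `ρ`, then so is the function `bump` attached to
`w` and a small compact open subgroup. -/
theorem bump_mem_funKer [IsLGroup J] (hJ : IsUnionOfCompactOpen J) (hρ : IsSmoothRep ρ)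
    (hθ : IsSmoothChar θ) {w : W} (hw : w ∈ twistKer ρ (θ.comp (Subgroup.inclusion hLJ))) :
    ∃ K₀ : Subgroup J, IsCO K₀ ∧ ∀ K ≤ K₀, IsCO K →
      w ∈ fixedSpace hLJ ρ K ∧ bump hLJ ρ K w ∈ funKer hLJ ρ θ := by
  induction hw using Submodule.span_induction with
  | mem w hw =>
    obtain ⟨u, v, rfl⟩ := hw
    obtain ⟨N₁, hN₁, h₁⟩ := exists_nhds_fixed hLJ hρ v
    obtain ⟨N₂, hN₂, h₂⟩ := exists_nhds_fixed hLJ hρ (ρ u v)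
    obtain ⟨K', hK'o, hK'c, hu⟩ := hJ (Subgroup.inclusion hLJ u)
    obtain ⟨K₀, hK₀o, hK₀c, hK₀, hconj⟩ := exists_compact_open_conj hK'o hK'c hu
      (Filter.inter_mem (Filter.inter_mem hN₁ hN₂) (hθ.mem_nhds (one_mem _)))
    have hK₀' : IsCO K₀ := ⟨hK₀o, hK₀c⟩
    have f₁ : v ∈ fixedSpace hLJ ρ K₀ := fun l hl => h₁ l (hK₀ hl).1.1
    have f₂ : ρ u v ∈ fixedSpace hLJ ρ K₀ := fun l hl => h₂ l (hK₀ hl).1.2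
    -- Because `u` normalizes `K₀`, replacing `v` by `ρ u v` is the same as translating the function
    -- by `u`.
    have e : bump hLJ ρ K₀ (ρ u v) = fun y => bump hLJ ρ K₀ v (y * Subgroup.inclusion hLJ u) := by
      ext y
      by_cases h : ∃ l : L, (Subgroup.inclusion hLJ l)⁻¹ * y ∈ K₀
      · obtain ⟨l, hl⟩ := h
        rw [bump_of_mem f₂ hl, bump_of_mem f₁ (l := l * u), map_mul, Module.End.mul_apply]
        simpa [mul_assoc] using (hconj _ hl).1
      · rw [bump_of_not_mem h, bump_of_not_mem]
        rintro ⟨l, hl⟩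
        refine h ⟨l * u⁻¹, ?_⟩
        simpa [mul_assoc] using (hconj _ hl).2
    have hmem : bump hLJ ρ K₀ (ρ u v - (θ (Subgroup.inclusion hLJ u) : ℂ) • v) ∈
        funKer hLJ ρ θ := by
      rw [sub_eq_add_neg, ← neg_one_smul ℂ, bump_add, bump_smul, bump_smul, e, neg_one_smul,
        ← sub_eq_add_neg]
      exact sub_mem_funKer (bump_mem_cIndSpace hK₀' f₁) _
    refine ⟨K₀, hK₀', fun K hK hKo => ?_⟩
    have f₃ : ρ u v - (θ (Subgroup.inclusion hLJ u) : ℂ) • v ∈ fixedSpace hLJ ρ K₀ :=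
      sub_mem f₂ (Submodule.smul_mem _ _ f₁)
    refine ⟨fixedSpace_anti hK f₃, ?_⟩
    -- `θ` is trivial on `K₀`, so `c` is nonzero and can be divided out when passing to `K`.
    obtain ⟨c, hc0, hc⟩ := exists_bump_sub_smul_mem (hLJ := hLJ) (ρ := ρ) (θ := θ) hK₀' hKo hK
    have := sub_mem hmem (hc _ f₃)
    rw [sub_sub_cancel] at this
    exact (Submodule.smul_mem_iff _ (hc0 fun k hk => (hK₀ hk).2)).1 this
  | zero =>
    obtain ⟨K₀, h, -⟩ := exists_isCO (J := J) Filter.univ_mem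
    exact ⟨K₀, h, fun K _ _ => ⟨Submodule.zero_mem _, by simp [bump_zero]⟩⟩
  | add w w' _ _ h h' =>
    obtain ⟨K₁, h₁, H₁⟩ := h
    obtain ⟨K₂, h₂, H₂⟩ := h'
    refine ⟨K₁ ⊓ K₂, h₁.inf h₂, fun K hK hKo => ?_⟩
    obtain ⟨f₁, k₁⟩ := H₁ K (hK.trans inf_le_left) hKo
    obtain ⟨f₂, k₂⟩ := H₂ K (hK.trans inf_le_right) hKo
    exact ⟨add_mem f₁ f₂, by rw [bump_add]; exact add_mem k₁ k₂⟩
  | smul a w _ h =>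
    obtain ⟨K₁, h₁, H₁⟩ := h
    refine ⟨K₁, h₁, fun K hK hKo => ?_⟩
    obtain ⟨f₁, k₁⟩ := H₁ K hK hKo
    exact ⟨Submodule.smul_mem _ _ f₁, by rw [bump_smul]; exact Submodule.smul_mem _ _ k₁⟩

/-- A `(J, θ)`-equivariant map on the induced space that on functions `bump` is a nonzero multiple
of the projection to the twisted coinvariants has only the obvious kernel. -/
theorem mem_funKer_of_apply_eq_zero [IsLGroup J] (hJ : IsUnionOfCompactOpen J)
    (hρ : IsSmoothRep ρ) (hθ : IsSmoothChar θ) {V : Type*} [AddCommGroup V] [Module ℂ V]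
    (A : cIndSpace hLJ ρ →ₗ[ℂ] V) (hA : ∀ u F, A (cInd hLJ ρ u F) = (θ u : ℂ) • A F)
    (hker : ∀ (K : Subgroup J) (hK : IsCO K), (∀ k ∈ K, θ k = 1) →
      ∀ (w : W) (hw : w ∈ fixedSpace hLJ ρ K), A ⟨_, bump_mem_cIndSpace hK hw⟩ = 0 →
      w ∈ twistKer ρ (θ.comp (Subgroup.inclusion hLJ)))
    (F : cIndSpace hLJ ρ) (hF : A F = 0) : F.1 ∈ funKer hLJ ρ θ := by
  have hle : funKer hLJ ρ θ ≤ (LinearMap.ker A).map (cIndSpace hLJ ρ).subtype := by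
    refine Submodule.span_le.2 ?_
    rintro _ ⟨u, F, hF, rfl⟩
    refine ⟨cInd hLJ ρ u ⟨F, hF⟩ - (θ u : ℂ) • (⟨F, hF⟩ : cIndSpace hLJ ρ), ?_, rfl⟩
    simp only [SetLike.mem_coe, LinearMap.mem_ker]
    rw [map_sub, map_smul, hA, sub_self]
  -- Replace `F` by a single `bump` function. Its vector `w` dies in the coinvariants by `hker`, so
  -- a `bump` function of `w` on a smaller subgroup is in `funKer`; shrinking `K` then brings `F` in
  -- as well.
  obtain ⟨K₀, hK₀, H⟩ := exists_sub_bump_mem (θ := θ) F.2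
  obtain ⟨K₁, hK₁, hK₁θ⟩ := exists_isCO (hθ.mem_nhds (one_mem _))
  have hK := hK₀.inf hK₁
  obtain ⟨w, hw, hFw⟩ := H _ inf_le_left hK
  have hw0 : w ∈ twistKer ρ (θ.comp (Subgroup.inclusion hLJ)) := by
    refine hker _ hK (fun k hk => hK₁θ hk.2) w hw ?_
    obtain ⟨F', hF', e⟩ := hle hFw
    have : F' = F - ⟨_, bump_mem_cIndSpace hK hw⟩ := Subtype.ext e
    subst this
    have h2 : A (F - ⟨_, bump_mem_cIndSpace hK hw⟩) = 0 := hF'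
    rw [map_sub, hF, zero_sub, neg_eq_zero] at h2
    exact h2
  obtain ⟨K₂, hK₂, H₂⟩ := bump_mem_funKer hJ hρ hθ hw0
  obtain ⟨c, -, hc⟩ := exists_bump_sub_smul_mem (hLJ := hLJ) (ρ := ρ) (θ := θ) hK (hK.inf hK₂)
    inf_le_left
  have h3 := add_mem hFw (add_mem (hc w hw) (Submodule.smul_mem _ c
    (H₂ _ inf_le_right (hK.inf hK₂)).2))
  rwa [sub_add_cancel, sub_add_cancel] at h3

end Coinvariants

/-! ### The invariant functional on `L \ J` -/

section Functional

open MeasureTheory MeasureTheory.Measure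

/-- Right translation by `g` preserves a compact open subgroup containing `g`. Its measure is finite
and nonzero, so the factor by which `g` scales Haar measure is `1`. -/
theorem isMulRightInvariant_haar {J : Type*} [Group J] [TopologicalSpace J] [IsLGroup J]
    [MeasurableSpace J] [BorelSpace J] (hJ : IsUnionOfCompactOpen J) :
    (haar : Measure J).IsMulRightInvariant := by
  refine ⟨fun g => ?_⟩
  obtain ⟨K, hKo, hKc, hg⟩ := hJ g
  have hreg : (map (· * g) (haar : Measure J)).Regular :=
    Regular.map (Homeomorph.mulRight g)
  have h := isMulLeftInvariant_eq_smul_of_regular (map (· * g) (haar : Measure J)) haar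
  have hK := congrArg (fun ν : Measure J => ν K) h
  have hpre : (· * g) ⁻¹' (K : Set J) = K := by
    ext x
    simp [K.mul_mem_cancel_right hg]
  simp only [Measure.smul_apply] at hK
  rw [map_apply (by fun_prop) hKo.measurableSet, hpre] at hK
  have hpos : haar (K : Set J) ≠ 0 := (hKo.measure_pos _ ⟨1, K.one_mem⟩).ne'
  have hfin : haar (K : Set J) ≠ ⊤ := hKc.measure_lt_top.ne
  rw [h]
  have : (haarScalarFactor (map (· * g) (haar : Measure J)) haar : ENNReal) = 1 := by
    rw [ENNReal.smul_def, smul_eq_mul] at hK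
    exact ((ENNReal.mul_eq_right hpos hfin).1 hK.symm)
  rw [ENNReal.coe_eq_one] at this
  rw [this, one_smul]

/-- Right invariance makes the inverted measure left invariant, hence proportional to Haar measure;
a compact open subgroup is its own inverse, so the factor is `1`. -/
theorem isInvInvariant_haar {J : Type*} [Group J] [TopologicalSpace J] [IsLGroup J]
    [MeasurableSpace J] [BorelSpace J] (hJ : IsUnionOfCompactOpen J) :
    (haar : Measure J).IsInvInvariant := by
  have := isMulRightInvariant_haar hJ
  refine ⟨?_⟩
  obtain ⟨K, hKo, hKc, -⟩ := hJ 1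
  have hreg : (haar : Measure J).inv.Regular := Regular.map (Homeomorph.inv J)
  have h := isMulLeftInvariant_eq_smul_of_regular (haar : Measure J).inv haar
  have hK := congrArg (fun ν : Measure J => ν K) h
  simp only [Measure.smul_apply] at hK
  rw [inv_apply, inv_coe_set] at hK
  have hpos : haar (K : Set J) ≠ 0 := (hKo.measure_pos _ ⟨1, K.one_mem⟩).ne'
  have hfin : haar (K : Set J) ≠ ⊤ := hKc.measure_lt_top.ne
  rw [h]
  have : (haarScalarFactor (haar : Measure J).inv haar : ENNReal) = 1 := by
    rw [ENNReal.smul_def, smul_eq_mul] at hK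
    exact ((ENNReal.mul_eq_right hpos hfin).1 hK.symm)
  rw [ENNReal.coe_eq_one] at this
  rw [this, one_smul]

variable {G₀ : Type*} [Group G₀] [TopologicalSpace G₀] [IsTopologicalGroup G₀]
  {L J : Subgroup G₀} {hLJ : L ≤ J}

theorem isClosedEmbedding_inclusion (hLJ : L ≤ J) (hL : IsClosed (L : Set G₀)) :
    IsClosedEmbedding (Subgroup.inclusion hLJ) := by
  refine ⟨⟨isInducing_inclusion hLJ, Subgroup.inclusion_injective hLJ⟩, ?_⟩
  have : Set.range (Subgroup.inclusion hLJ) = ((↑) : J → G₀) ⁻¹' (L : Set G₀) := by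
    ext x
    constructor
    · rintro ⟨l, rfl⟩
      exact l.2
    · exact fun hx => ⟨⟨x, hx⟩, rfl⟩
  rw [this]
  exact hL.preimage continuous_subtype_val

theorem IsUnionOfCompactOpen.of_le (hLJ : L ≤ J) (hL : IsClosed (L : Set G₀))
    (hJ : IsUnionOfCompactOpen J) : IsUnionOfCompactOpen L := fun l => by
  obtain ⟨K, hKo, hKc, hl⟩ := hJ (Subgroup.inclusion hLJ l)
  have := isClosedEmbedding_inclusion hLJ hL
  exact ⟨K.comap (Subgroup.inclusion hLJ), hKo.preimage this.continuous,
    this.isCompact_preimage hKc, hl⟩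

variable [IsLGroup L] [IsLGroup J]

section OrbitIntegral

variable [MeasurableSpace L] [BorelSpace L] [MeasurableSpace J] [BorelSpace J]

/-- The function `u ↦ ∫ β (l u) dl`. -/
def orbitIntegral (hLJ : L ≤ J) (β : J → ℂ) (u : J) : ℂ :=
  ∫ l : L, β (Subgroup.inclusion hLJ l * u) ∂haar

/-- By Fubini both sides are double integrals over `L` and `J`, exchanged by `l ↦ l⁻¹` and `u ↦ l
u`. When both orbit integrals are `1` on the support of `φ`, this says that `∫ φ β` does not depend
on the cutoff `β`. -/
theorem integral_mul_orbitIntegral (hL : IsClosed (L : Set G₀)) (hJ : IsUnionOfCompactOpen J)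
    {φ β β' : J → ℂ} (hφ : Continuous φ)
    (hinv : ∀ (l : L) (u : J), φ (Subgroup.inclusion hLJ l * u) = φ u)
    (hβ : Continuous β) (hβc : HasCompactSupport β)
    (hβ' : Continuous β') (hβc' : HasCompactSupport β') :
    ∫ u, φ u * β u * orbitIntegral hLJ β' u ∂haar =
      ∫ u, φ u * β' u * orbitIntegral hLJ β u ∂haar := by
  have hce := isClosedEmbedding_inclusion hLJ hL
  have hcont := hce.continuous
  have := isInvInvariant_haar (hJ.of_le hLJ hL)
  have fubini : ∀ {β β' : J → ℂ}, Continuous β → HasCompactSupport β → Continuous β' →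
      HasCompactSupport β' → ∫ u, φ u * β u * orbitIntegral hLJ β' u ∂haar =
        ∫ l : L, ∫ u, φ u * β u * β' (Subgroup.inclusion hLJ l * u) ∂haar ∂haar := by
    intro β β' hβ hβc hβ' hβc'
    simp_rw [orbitIntegral, ← integral_const_mul]
    refine integral_integral_swap_of_hasCompactSupport
      (f := fun (u : J) (l : L) => φ u * β u * β' (Subgroup.inclusion hLJ l * u)) ?_ ?_
    · unfold Function.uncurry
      fun_prop
    -- If `u` and `l u` lie in the two supports, then `l` lies in a compact subset of `J`, whose
    -- trace on the closed subgroup `L` is compact.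
    · refine HasCompactSupport.intro (K := tsupport β ×ˢ (Subgroup.inclusion hLJ ⁻¹'
        ((fun p : J × J => p.1 * p.2⁻¹) '' (tsupport β' ×ˢ tsupport β)))) ?_ ?_
      · refine hβc.isCompact.prod (hce.isCompact_preimage ?_)
        exact (hβc'.isCompact.prod hβc.isCompact).image (by fun_prop)
      · rintro ⟨u, l⟩ hul
        by_contra hne
        refine hul ⟨subset_tsupport _ fun h0 => hne ?_, ⟨(Subgroup.inclusion hLJ l * u, u),
          ⟨subset_tsupport _ fun h0 => hne ?_, subset_tsupport _ fun h0 => hne ?_⟩, by simp⟩⟩ <;>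
        simp [Function.uncurry, h0]
  rw [fubini hβ hβc hβ' hβc', fubini hβ' hβc' hβ hβc,
    ← integral_inv_eq_self (μ := (haar : Measure L))]
  refine integral_congr_ae (Filter.Eventually.of_forall fun l => ?_)
  dsimp only
  rw [← integral_mul_left_eq_self _ (Subgroup.inclusion hLJ l)]
  refine integral_congr_ae (Filter.Eventually.of_forall fun u => ?_)
  simp only [hinv, map_inv, inv_mul_cancel_left]
  ring

theorem orbitIntegral_indicator (hL : IsClosed (L : Set G₀)) {B : Set J} (hBo : IsOpen B) (u : J) :
    orbitIntegral hLJ (B.indicator 1) u =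
      ((haar : Measure L).real {l | Subgroup.inclusion hLJ l * u ∈ B} : ℂ) := by
  have hm : MeasurableSet {l | Subgroup.inclusion hLJ l * u ∈ B} :=
    (hBo.preimage (((isClosedEmbedding_inclusion hLJ hL).continuous).mul
      continuous_const)).measurableSet
  have := integral_indicator_const (μ := (haar : Measure L)) (1 : ℂ) hm
  rw [Complex.real_smul, mul_one] at this
  exact this

theorem orbitIntegral_indicator_ne_zero (hL : IsClosed (L : Set G₀)) {B : Set J} (hBo : IsOpen B)
    (hBc : IsCompact B) {u : J} {l : L} (hl : Subgroup.inclusion hLJ l * u ∈ B) :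
    orbitIntegral hLJ (B.indicator 1) u ≠ 0 := by
  have hce := isClosedEmbedding_inclusion hLJ hL
  rw [orbitIntegral_indicator hL hBo, Complex.ofReal_ne_zero, measureReal_def]
  have ho : IsOpen {l | Subgroup.inclusion hLJ l * u ∈ B} :=
    hBo.preimage (hce.continuous.mul continuous_const)
  have hc : IsCompact {l | Subgroup.inclusion hLJ l * u ∈ B} :=
    hce.isCompact_preimage ((Homeomorph.isCompact_preimage (Homeomorph.mulRight u)).2 hBc)
  exact ENNReal.toReal_ne_zero.2 ⟨(ho.measure_pos _ ⟨l, hl⟩).ne', hc.measure_lt_top.ne⟩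

theorem orbitIntegral_mul_left (hL : IsClosed (L : Set G₀)) (hJ : IsUnionOfCompactOpen J)
    (β : J → ℂ) (l : L) (u : J) :
    orbitIntegral hLJ β (Subgroup.inclusion hLJ l * u) = orbitIntegral hLJ β u := by
  have := isMulRightInvariant_haar (hJ.of_le hLJ hL)
  have h := integral_mul_right_eq_self (μ := (haar : Measure L))
    (fun l' => β (Subgroup.inclusion hLJ l' * u)) l
  simpa [orbitIntegral, mul_assoc] using h

/-- A cutoff function for `L C`, where `C` is compact. -/
theorem exists_orbitIntegral_eq_one (hL : IsClosed (L : Set G₀)) (hJ : IsUnionOfCompactOpen J)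
    {C : Set J} (hC : IsCompact C) : ∃ β : J → ℂ, Continuous β ∧ HasCompactSupport β ∧
      ∀ (l : L), ∀ c ∈ C, orbitIntegral hLJ β (Subgroup.inclusion hLJ l * c) = 1 := by
  obtain ⟨K, hK, -⟩ := exists_isCO (J := J) Filter.univ_mem
  set B : Set J := (fun p : J × J => p.1 * p.2) '' (C ×ˢ (K : Set J)) with hB
  have hBc : IsCompact B := (hC.prod hK.2).image continuous_mul
  have hBK : ∀ b ∈ B, ∀ k ∈ K, b * k ∈ B := by
    rintro _ ⟨⟨c, k⟩, ⟨hc, hk⟩, rfl⟩ k' hk'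
    exact ⟨(c, k * k'), ⟨hc, K.mul_mem hk hk'⟩, by simp [mul_assoc]⟩
  have hBK' : ∀ b, ∀ k ∈ K, (b * k ∈ B ↔ b ∈ B) := fun b k hk =>
    ⟨fun h => by simpa using hBK _ h _ (K.inv_mem hk), fun h => hBK _ h _ hk⟩
  have hBo : IsOpen B := (isClopen_of_mul_mem ⟨K, hK.1⟩ hBK).isOpen
  set k : J → ℂ := orbitIntegral hLJ (B.indicator 1) with hk
  have hkl : ∀ (l : L) u, k (Subgroup.inclusion hLJ l * u) = k u :=
    orbitIntegral_mul_left hL hJ _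
  have hkr : ∀ x ∈ K, ∀ u, k (u * x) = k u := fun x hx u => by
    rw [hk, orbitIntegral_indicator hL hBo, orbitIntegral_indicator hL hBo]
    simp_rw [← mul_assoc, hBK' _ x hx]
  -- The indicator of `B = C K` is normalized by its own orbit integral `k`; as `k` is left
  -- `L`-invariant, it comes out of the integral.
  refine ⟨fun u => B.indicator 1 u * (k u)⁻¹, ?_, ?_, fun l c hc => ?_⟩
  · refine (isLocallyConstant_of_right_invariant ⟨K, hK.1⟩ fun x hx u => ?_).continuous
    rw [hkr x hx]
    congr 1
    by_cases hu : u ∈ B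
    · simp [hu, (hBK' u x hx).2 hu]
    · simp [hu, mt (hBK' u x hx).1 hu]
  · refine HasCompactSupport.intro hBc fun x hx => ?_
    simp [hx]
  · have hne : k c ≠ 0 := orbitIntegral_indicator_ne_zero hL hBo hBc (l := 1)
      ⟨(c, 1), ⟨hc, K.one_mem⟩, by simp⟩
    have : orbitIntegral hLJ (fun u => B.indicator 1 u * (k u)⁻¹) c = k c * (k c)⁻¹ := by
      conv_rhs => rw [hk]
      rw [orbitIntegral, orbitIntegral, ← integral_mul_const]
      simp_rw [hkl]
      rfl
    rw [orbitIntegral_mul_left hL hJ, this, mul_inv_cancel₀ hne]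

end OrbitIntegral

/-- There is a nonzero right invariant functional on the locally constant compactly supported
functions on `L \ J`. -/
theorem exists_invariant_functional (hL : IsClosed (L : Set G₀)) (hJ : IsUnionOfCompactOpen J) :
    ∃ I : quotSchwartz hLJ →ₗ[ℂ] ℂ,
      (∀ (x : J) (φ : quotSchwartz hLJ), I (quotTranslate hLJ x φ) = I φ) ∧
      ∀ K : Subgroup J, IsCO K → ∀ φ : quotSchwartz hLJ,
        (∀ (l : L), ∀ k ∈ K, φ.1 (Subgroup.inclusion hLJ l * k) = 1) →
        (∀ u, φ.1 u ≠ 0 → ∃ l : L, ∃ k ∈ K, u = Subgroup.inclusion hLJ l * k) → I φ ≠ 0 := by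
  let _ : MeasurableSpace J := borel J
  have : BorelSpace J := ⟨rfl⟩
  let _ : MeasurableSpace L := borel L
  have : BorelSpace L := ⟨rfl⟩
  have hr := isMulRightInvariant_haar hJ
  let good : quotSchwartz hLJ → (J → ℂ) → Prop := fun φ β => Continuous β ∧
    HasCompactSupport β ∧ ∀ u, φ.1 u ≠ 0 → orbitIntegral hLJ β u = 1
  have hgood : ∀ φ, ∃ β, good φ β := fun φ => by
    obtain ⟨-, -, C, hC, hs⟩ := φ.2
    obtain ⟨β, h1, h2, h3⟩ := exists_orbitIntegral_eq_one (hLJ := hLJ) hL hJ hC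
    refine ⟨β, h1, h2, fun u hu => ?_⟩
    obtain ⟨l, c, hc, rfl⟩ := hs u hu
    exact h3 l c hc
  choose b hb using hgood
  -- Integration over `L \ J` becomes integration over `J` against a cutoff. By `spec` any good
  -- cutoff gives the same value, so linearity uses a common cutoff and invariance a translated one.
  let I₀ : quotSchwartz hLJ → ℂ := fun φ => ∫ u, φ.1 u * b φ u ∂haar
  have spec : ∀ φ β, good φ β → I₀ φ = ∫ u, φ.1 u * β u ∂haar := by
    intro φ β hβ
    have key := integral_mul_orbitIntegral (hLJ := hLJ) hL hJ φ.2.1.continuous φ.2.2.1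
      (hb φ).1 (hb φ).2.1 hβ.1 hβ.2.1
    have e : ∀ β β' : J → ℂ, (∀ u, φ.1 u ≠ 0 → orbitIntegral hLJ β' u = 1) →
        ∀ u, φ.1 u * β u * orbitIntegral hLJ β' u = φ.1 u * β u := by
      intro β β' h u
      by_cases h0 : φ.1 u = 0
      · simp [h0]
      · rw [h u h0, mul_one]
    simp_rw [e _ _ hβ.2.2, e _ _ (hb φ).2.2] at key
    exact key
  have int : ∀ (φ : quotSchwartz hLJ) (β : J → ℂ), Continuous β → HasCompactSupport β →
      Integrable (fun u => φ.1 u * β u) haar := fun φ β h1 h2 =>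
    (φ.2.1.continuous.mul h1).integrable_of_hasCompactSupport h2.mul_left
  refine ⟨⟨⟨I₀, fun φ ψ => ?_⟩, fun a φ => ?_⟩, fun x φ => ?_, fun K hK φ h1 h2 => ?_⟩
  · obtain ⟨-, -, C, hC, hs⟩ := φ.2
    obtain ⟨-, -, C', hC', hs'⟩ := ψ.2
    obtain ⟨β, hβ, hβc, hβ1⟩ := exists_orbitIntegral_eq_one (hLJ := hLJ) hL hJ (hC.union hC')
    have g1 : good φ β := ⟨hβ, hβc, fun u hu => by
      obtain ⟨l, c, hc, rfl⟩ := hs u hu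
      exact hβ1 l c (Or.inl hc)⟩
    have g2 : good ψ β := ⟨hβ, hβc, fun u hu => by
      obtain ⟨l, c, hc, rfl⟩ := hs' u hu
      exact hβ1 l c (Or.inr hc)⟩
    have g3 : good (φ + ψ) β := ⟨hβ, hβc, fun u hu => by
      by_cases h0 : φ.1 u = 0
      · exact g2.2.2 u fun h0' => hu (by simp [h0, h0'])
      · exact g1.2.2 u h0⟩
    rw [spec _ _ g1, spec _ _ g2, spec _ _ g3, ← integral_add (int φ β hβ hβc) (int ψ β hβ hβc)]
    simp [add_mul]
  · have g : good (a • φ) (b φ) := ⟨(hb φ).1, (hb φ).2.1, fun u hu =>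
      (hb φ).2.2 u fun h0 => hu (by simp [h0])⟩
    change I₀ (a • φ) = a • I₀ φ
    rw [spec _ _ g, smul_eq_mul, ← integral_const_mul]
    simp [mul_assoc]
  · change I₀ _ = I₀ _
    have g : good (quotTranslate hLJ x φ) (fun u => b φ (u * x)) := by
      refine ⟨(hb φ).1.comp (continuous_mul_const x),
        (hb φ).2.1.comp_homeomorph (Homeomorph.mulRight x), fun u hu => ?_⟩
      have := (hb φ).2.2 (u * x) hu
      simpa [orbitIntegral, mul_assoc] using this
    rw [spec _ _ g]
    exact integral_mul_right_eq_self (μ := haar) (fun u => φ.1 u * b φ u) x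
  · change I₀ φ ≠ 0
    set c := orbitIntegral hLJ ((K : Set J).indicator 1) 1 with hc
    have hc0 : c ≠ 0 := orbitIntegral_indicator_ne_zero hL hK.1 hK.2 (l := 1)
      (by simp [K.one_mem])
    have hck : ∀ k ∈ K, orbitIntegral hLJ ((K : Set J).indicator 1) k = c := fun k hk => by
      rw [hc, orbitIntegral_indicator hL hK.1, orbitIntegral_indicator hL hK.1]
      simp only [SetLike.mem_coe, mul_one, K.mul_mem_cancel_right hk]
    -- For the characteristic function of `L K`, a multiple of the indicator of `K` is a good
    -- cutoff, and the integral is the volume of `K` divided by `c`.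
    have g : good φ (fun u => (K : Set J).indicator 1 u * c⁻¹) := by
      refine ⟨?_, ?_, fun u hu => ?_⟩
      · refine Continuous.mul ?_ continuous_const
        exact continuous_one.indicator (by
          rw [isClopen_iff_frontier_eq_empty.1 ⟨Subgroup.isClosed_of_isOpen _ hK.1, hK.1⟩]
          simp)
      · exact HasCompactSupport.intro hK.2 fun x hx => by simp [show x ∉ (K : Set J) from hx]
      · obtain ⟨l, k, hk, rfl⟩ := h2 u hu
        rw [orbitIntegral_mul_left hL hJ, orbitIntegral, integral_mul_const]
        change orbitIntegral hLJ ((K : Set J).indicator 1) k * c⁻¹ = 1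
        rw [hck k hk, mul_inv_cancel₀ hc0]
    rw [spec _ _ g]
    have e : (fun u => φ.1 u * ((K : Set J).indicator 1 u * c⁻¹)) =
        (K : Set J).indicator fun _ => c⁻¹ := by
      ext u
      by_cases hu : u ∈ K
      · have := h1 1 u hu
        rw [map_one, one_mul] at this
        simp [hu, this]
      · simp [hu]
    rw [e, integral_indicator_const _ hK.1.measurableSet]
    refine smul_ne_zero ?_ (inv_ne_zero hc0)
    exact ENNReal.toReal_ne_zero.2 ⟨(hK.1.measure_pos _ ⟨1, K.one_mem⟩).ne',
      hK.2.measure_lt_top.ne⟩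

end Functional

/-! ### Vector-valued integrals -/

section VectorIntegral

variable {G₀ : Type*} [Group G₀] [TopologicalSpace G₀] [IsTopologicalGroup G₀]
  {L J : Subgroup G₀} {V : Type*} [AddCommGroup V] [Module ℂ V]

/-- The composition of a left `L`-invariant vector-valued function with a scalar function that
vanishes at `0`. -/
theorem comp_mem_quotSchwartz {hLJ : L ≤ J} (c : V → ℂ) (hc : c 0 = 0)
    (Ψ : cIndSpace hLJ (1 : Representation ℂ L V)) :
    (fun u => c (Ψ.1 u)) ∈ quotSchwartz hLJ := by
  have hlc := isLocallyConstant_of_mem_cIndSpace Ψ.2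
  obtain ⟨-, heq, C, hC, hs⟩ := Ψ.2
  refine ⟨hlc.comp c, fun l u => ?_, C, hC, fun u hu => hs u fun h0 => hu ?_⟩
  · dsimp only
    rw [heq]
    rfl
  · dsimp only
    rw [h0, hc]

/-- The composition with a linear functional. -/
def dualComp (hLJ : L ≤ J) (ev : V →ₗ[ℂ] ℂ) :
    cIndSpace hLJ (1 : Representation ℂ L V) →ₗ[ℂ] quotSchwartz hLJ where
  toFun Ψ := ⟨fun u => ev (Ψ.1 u), comp_mem_quotSchwartz ev (map_zero ev) Ψ⟩
  map_add' _ _ := Subtype.ext (funext fun _ => map_add ev _ _)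
  map_smul' _ _ := Subtype.ext (funext fun _ => map_smul ev _ _)

/-- `V` carries no topology, so vector-valued integrals are pinned down by their images under all
linear functionals. -/
theorem eq_of_forall_dual {v w : V} (h : ∀ ev : V →ₗ[ℂ] ℂ, ev v = ev w) : v = w := by
  rw [← sub_eq_zero]
  refine (Module.forall_dual_apply_eq_zero_iff ℂ _).1 fun ev => ?_
  rw [map_sub, h ev, sub_self]

/-- A functional on scalar functions extends to vector-valued functions. -/
theorem exists_vectorIntegral {hLJ : L ≤ J} (I : quotSchwartz hLJ →ₗ[ℂ] ℂ) :
    ∃ A : cIndSpace hLJ (1 : Representation ℂ L V) →ₗ[ℂ] V,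
      ∀ (ev : V →ₗ[ℂ] ℂ) Ψ, ev (A Ψ) = I (dualComp hLJ ev Ψ) := by
  classical
  have key : ∀ Ψ : cIndSpace hLJ (1 : Representation ℂ L V), ∃ v : V,
      ∀ ev : V →ₗ[ℂ] ℂ, ev v = I (dualComp hLJ ev Ψ) := by
    intro Ψ
    have hlc := isLocallyConstant_of_mem_cIndSpace Ψ.2
    obtain ⟨-, heq, C, hC, hs⟩ := id Ψ.2
    have hfin : (Ψ.1 '' C).Finite := by
      -- For the discrete topology `Ψ` is continuous, so it takes finitely many values on `C` and
      -- the integral is a finite sum.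
      let _ : TopologicalSpace V := ⊥
      have : DiscreteTopology V := ⟨rfl⟩
      exact (hC.image hlc.continuous).finite_of_discrete
    let T := hfin.toFinset.erase 0
    -- The condition `w ≠ 0` makes `χ w` vanish at `0`, which keeps supports compact modulo `L`.
    let χ : V → V → ℂ := fun w x => if x = w ∧ w ≠ 0 then 1 else 0
    have hχ : ∀ w, χ w 0 = 0 := fun w => if_neg fun h => h.2 h.1.symm
    let φ : V → quotSchwartz hLJ := fun w =>
      ⟨fun u => χ w (Ψ.1 u), comp_mem_quotSchwartz (χ w) (hχ w) Ψ⟩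
    refine ⟨∑ w ∈ T, I (φ w) • w, fun ev => ?_⟩
    have hsum : dualComp hLJ ev Ψ = ∑ w ∈ T, ev w • φ w := by
      refine Subtype.ext (funext fun u => ?_)
      have e1 : (∑ w ∈ T, ev w • φ w : quotSchwartz hLJ).1 u = ∑ w ∈ T, ev w * χ w (Ψ.1 u) := by
        simp [φ]
      rw [e1]
      change ev (Ψ.1 u) = _
      by_cases h0 : Ψ.1 u = 0
      · simp [h0, hχ]
      · have hT : Ψ.1 u ∈ T := by
          obtain ⟨l, c, hc, rfl⟩ := hs u h0
          refine Finset.mem_erase.2 ⟨h0, hfin.mem_toFinset.2 ⟨c, hc, ?_⟩⟩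
          rw [heq]
          rfl
        rw [Finset.sum_eq_single_of_mem _ hT]
        · simp [χ, h0]
        · intro w _ hw
          simp [χ, hw.symm]
    rw [hsum]
    simp [mul_comm]
  choose A hA using key
  refine ⟨⟨⟨A, fun Ψ Ψ' => ?_⟩, fun a Ψ => ?_⟩, fun ev Ψ => hA Ψ ev⟩
  · exact eq_of_forall_dual fun ev => by simp [hA]
  · exact eq_of_forall_dual fun ev => by simp [hA]

variable {W : Type*} [AddCommGroup W] [Module ℂ W] {ρ : Representation ℂ L W} {θ : J →* ℂˣ}

/-- The map `F ↦ θ⁻¹ (q ∘ F)`, where `q` is a `θ`-equivariant map. -/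
def twistMap (hLJ : L ≤ J) (hθ : IsSmoothChar θ) (q : W →ₗ[ℂ] V)
    (hq : ∀ l w, q (ρ l w) = (θ (Subgroup.inclusion hLJ l) : ℂ) • q w) :
    cIndSpace hLJ ρ →ₗ[ℂ] cIndSpace hLJ (1 : Representation ℂ L V) where
  toFun F := ⟨fun u => ((θ u)⁻¹ : ℂˣ) • q (F.1 u), by
    obtain ⟨⟨K, hK⟩, heq, C, hC, hs⟩ := F.2
    refine ⟨⟨K ⊓ ⟨θ.ker, hθ⟩, fun k hk u => ?_⟩, fun l u => ?_, C, hC, fun u hu =>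
      hs u fun h0 => hu ?_⟩
    · obtain ⟨h1, h2⟩ := OpenSubgroup.mem_inf.1 hk
      have h2' : θ k = 1 := h2
      dsimp only
      rw [hK k h1, map_mul, h2', mul_one]
    · dsimp only
      rw [heq, hq, map_mul, mul_inv_rev, mul_smul]
      change (θ u)⁻¹ • (θ (Subgroup.inclusion hLJ l))⁻¹ •
        θ (Subgroup.inclusion hLJ l) • q (F.1 u) = _
      rw [inv_smul_smul]
      rfl
    · simp [h0]⟩
  map_add' F F' := Subtype.ext (funext fun u => by simp)
  map_smul' a F := Subtype.ext (funext fun u => by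
    change (θ u)⁻¹ • q (a • F.1 u) = a • (θ u)⁻¹ • q (F.1 u)
    rw [map_smul, smul_comm])

/-- The characteristic function of `L K`. -/
def quotBump (hLJ : L ≤ J) {K : Subgroup J} (hK : IsCO K) : quotSchwartz hLJ :=
  dualComp hLJ LinearMap.id ⟨bump hLJ (1 : Representation ℂ L ℂ) K 1,
    bump_mem_cIndSpace hK fun _ _ => rfl⟩

theorem quotBump_mul (hLJ : L ≤ J) {K : Subgroup J} (hK : IsCO K) (l : L) {k : J} (hk : k ∈ K) :
    (quotBump hLJ hK).1 (Subgroup.inclusion hLJ l * k) = 1 :=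
  bump_mul (fun _ _ => rfl) l hk

theorem quotBump_of_not_mem (hLJ : L ≤ J) {K : Subgroup J} (hK : IsCO K) {u : J}
    (h : ¬ ∃ l : L, ∃ k ∈ K, u = Subgroup.inclusion hLJ l * k) : (quotBump hLJ hK).1 u = 0 :=
  bump_of_not_mem fun ⟨l, hl⟩ => h ⟨l, _, hl, by simp⟩

/-- A right invariant functional on `L \ J` that does not vanish on characteristic functions. -/
def IsInvariantIntegral (hLJ : L ≤ J) (I : quotSchwartz hLJ →ₗ[ℂ] ℂ) : Prop :=
  (∀ (x : J) (φ : quotSchwartz hLJ), I (quotTranslate hLJ x φ) = I φ) ∧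
    ∀ (K : Subgroup J) (hK : IsCO K), I (quotBump hLJ hK) ≠ 0

theorem exists_isInvariantIntegral [IsLGroup L] [IsLGroup J] (hLJ : L ≤ J)
    (hL : IsClosed (L : Set G₀)) (hJ : IsUnionOfCompactOpen J) :
    ∃ I, IsInvariantIntegral hLJ I := by
  obtain ⟨I, h1, h2⟩ := exists_invariant_functional (hLJ := hLJ) hL hJ
  refine ⟨I, h1, fun K hK => h2 K hK _ (fun l k hk => quotBump_mul hLJ hK l hk) fun u hu => ?_⟩
  by_contra h
  exact hu (quotBump_of_not_mem hLJ hK h)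

/-- The twisted integral `F ↦ ∫ θ⁻¹ (q ∘ F)` over `L \ J` identifies the twisted coinvariants of
the induced space with those of `ρ`. -/
theorem exists_twistedIntegral [IsLGroup J] {hLJ : L ≤ J} (hJ : IsUnionOfCompactOpen J)
    (hρ : IsSmoothRep ρ) (hθ : IsSmoothChar θ) {I : quotSchwartz hLJ →ₗ[ℂ] ℂ}
    (hI : IsInvariantIntegral hLJ I) (q : W →ₗ[ℂ] V)
    (hq : ∀ l w, q (ρ l w) = (θ (Subgroup.inclusion hLJ l) : ℂ) • q w)
    (hker : LinearMap.ker q ≤ twistKer ρ (θ.comp (Subgroup.inclusion hLJ))) :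
    ∃ A : cIndSpace hLJ ρ →ₗ[ℂ] V,
      (∀ (ev : V →ₗ[ℂ] ℂ) F, ev (A F) = I (dualComp hLJ ev (twistMap hLJ hθ q hq F))) ∧
      (∀ u F, A (cInd hLJ ρ u F) = (θ u : ℂ) • A F) ∧
      (∀ F, A F = 0 → F.1 ∈ funKer hLJ ρ θ) ∧
      ∀ w, ∃ F, A F = q w := by
  obtain ⟨A₀, hA₀⟩ := exists_vectorIntegral (V := V) I
  set A := A₀ ∘ₗ twistMap hLJ hθ q hq with hAdef
  have hA : ∀ (ev : V →ₗ[ℂ] ℂ) F, ev (A F) = I (dualComp hLJ ev (twistMap hLJ hθ q hq F)) :=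
    fun ev F => hA₀ ev _
  have hequiv : ∀ u F, A (cInd hLJ ρ u F) = (θ u : ℂ) • A F := by
    intro u F
    refine eq_of_forall_dual fun ev => ?_
    rw [map_smul, hA, hA, ← hI.1 u (dualComp hLJ ev (twistMap hLJ hθ q hq F)), ← map_smul]
    congr 1
    refine Subtype.ext (funext fun y => ?_)
    change ev ((θ y)⁻¹ • q (F.1 (y * u))) = (θ u : ℂ) * ev ((θ (y * u))⁻¹ • q (F.1 (y * u)))
    have e : (θ y)⁻¹ • q (F.1 (y * u)) = (θ u : ℂ) • (θ (y * u))⁻¹ • q (F.1 (y * u)) := by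
      change _ = θ u • (θ (y * u))⁻¹ • q (F.1 (y * u))
      rw [smul_smul, map_mul, mul_inv_rev, mul_inv_cancel_left]
    rw [e, map_smul, smul_eq_mul]
  -- As `θ` is trivial on `K`, the twisted integrand is `q w` times the characteristic function of
  -- `L K`.
  have hbump : ∀ (K : Subgroup J) (hK : IsCO K), (∀ k ∈ K, θ k = 1) →
      ∀ (w : W) (hw : w ∈ fixedSpace hLJ ρ K), A ⟨_, bump_mem_cIndSpace hK hw⟩ =
        I (quotBump hLJ hK) • q w := by
    intro K hK hθK w hw
    refine eq_of_forall_dual fun ev => ?_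
    rw [map_smul, hA, smul_eq_mul, mul_comm, ← smul_eq_mul, ← map_smul]
    congr 1
    refine Subtype.ext (funext fun y => ?_)
    change ev ((θ y)⁻¹ • q (bump hLJ ρ K w y)) = ev (q w) * (quotBump hLJ hK).1 y
    by_cases h : ∃ l : L, (Subgroup.inclusion hLJ l)⁻¹ * y ∈ K
    · obtain ⟨l, hl⟩ := h
      obtain ⟨k, hk, rfl⟩ : ∃ k ∈ K, y = Subgroup.inclusion hLJ l * k := ⟨_, hl, by simp⟩
      rw [bump_mul hw l hk, quotBump_mul hLJ hK l hk, hq, map_mul, hθK k hk, mul_one, mul_one]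
      change ev ((θ (Subgroup.inclusion hLJ l))⁻¹ • θ (Subgroup.inclusion hLJ l) • q w) = _
      rw [inv_smul_smul]
    · rw [bump_of_not_mem h, quotBump_of_not_mem hLJ hK]
      · simp
      · rintro ⟨l, k, hk, rfl⟩
        exact h ⟨l, by simpa⟩
  refine ⟨A, hA, hequiv, fun F hF => ?_, fun w => ?_⟩
  · refine mem_funKer_of_apply_eq_zero hJ hρ hθ A hequiv (fun K hK hθK w hw h0 => hker ?_) F hF
    rw [hbump K hK hθK w hw] at h0
    exact (smul_eq_zero.1 h0).resolve_left (hI.2 K hK)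
  · obtain ⟨N, hN, hfix⟩ := exists_nhds_fixed hLJ hρ w
    obtain ⟨K, hK, hKN⟩ := exists_isCO (Filter.inter_mem hN (hθ.mem_nhds (one_mem _)))
    have hw : w ∈ fixedSpace hLJ ρ K := fun l hl => hfix l (hKN hl).1
    refine ⟨(I (quotBump hLJ hK))⁻¹ • ⟨_, bump_mem_cIndSpace hK hw⟩, ?_⟩
    rw [map_smul, hbump K hK (fun k hk => (hKN hk).2) w hw, inv_smul_smul₀ (hI.2 K hK)]

end VectorIntegral

/-! ### The module of the action by conjugation -/

section QuotModule

variable {G₀ : Type*} [Group G₀] [TopologicalSpace G₀] [IsTopologicalGroup G₀]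
  {L J : Subgroup G₀}

theorem isSmoothRep_one {L V : Type*} [Group L] [TopologicalSpace L] [AddCommGroup V]
    [Module ℂ V] : IsSmoothRep (1 : Representation ℂ L V) := fun w => by
  simp

/-- Right invariant functionals on `L \ J` are unique up to scalars. -/
theorem apply_eq_zero_of_invariant [IsLGroup J] {hLJ : L ≤ J} (hJ : IsUnionOfCompactOpen J)
    {I : quotSchwartz hLJ →ₗ[ℂ] ℂ} (hI : IsInvariantIntegral hLJ I)
    {I' : quotSchwartz hLJ →ₗ[ℂ] ℂ}
    (hI' : ∀ (x : J) (φ : quotSchwartz hLJ), I' (quotTranslate hLJ x φ) = I' φ)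
    {φ : quotSchwartz hLJ} (hφ : I φ = 0) : I' φ = 0 := by
  have hθ : IsSmoothChar (1 : J →* ℂˣ) := by
    simp [IsSmoothChar]
  -- For the trivial representation and `θ = 1`, the integral `A` is `I` itself. So the kernel of
  -- `I` is spanned by differences of translates, which `I'` kills.
  obtain ⟨A, hA, -, hAker, -⟩ := exists_twistedIntegral (θ := 1) hJ
    (isSmoothRep_one (L := L) (V := ℂ)) hθ hI LinearMap.id (by simp) (by simp)
  have hφ' : φ.1 ∈ cIndSpace hLJ (1 : Representation ℂ L ℂ) := by
    obtain ⟨hlc, heq, C, hC, hs⟩ := φ.2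
    exact mem_cIndSpace_of_isLocallyConstant hlc heq hC hs
  have h0 : A ⟨φ.1, hφ'⟩ = 0 := by
    have := hA LinearMap.id ⟨φ.1, hφ'⟩
    rw [LinearMap.id_apply] at this
    rw [this, ← hφ]
    congr 1
    refine Subtype.ext (funext fun y => ?_)
    simp [dualComp, twistMap]
  have hle : funKer hLJ (1 : Representation ℂ L ℂ) 1 ≤
      (LinearMap.ker I').map (quotSchwartz hLJ).subtype := by
    refine Submodule.span_le.2 ?_
    rintro _ ⟨u, F, hF, rfl⟩
    set F' := dualComp hLJ LinearMap.id ⟨F, hF⟩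
    refine ⟨quotTranslate hLJ u F' - F', ?_, ?_⟩
    · simp only [SetLike.mem_coe, LinearMap.mem_ker, map_sub, hI', sub_self]
    · ext y
      simp [F', dualComp, quotTranslate]
  obtain ⟨ψ, hψ, e⟩ := hle (hAker _ h0)
  have : ψ = φ := Subtype.ext e
  rw [← this]
  exact hψ

variable {U₀ U H : Subgroup G₀} {hU : U₀ ≤ U}
  {hN : ∀ (h : H) (u : G₀), u ∈ U ↔ (h : G₀) * u * (h : G₀)⁻¹ ∈ U}
  {hN₀ : ∀ (h : H) (u : G₀), u ∈ U₀ ↔ (h : G₀) * u * (h : G₀)⁻¹ ∈ U₀}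

/-- Conjugation by `h` turns translation by `x` into translation by `h x h⁻¹`, so it preserves
invariance of functionals. By uniqueness up to scalars it multiplies `I` by a number, read off at
the test function `φ₀`; that number is `m h`. -/
theorem existsUnique_isQuotModule [IsLGroup U] {I : quotSchwartz hU →ₗ[ℂ] ℂ}
    (hI : IsInvariantIntegral hU I) (hUnion : IsUnionOfCompactOpen U) :
    ∃! m : H →* ℂˣ, IsQuotModule hU H hN hN₀ m := by
  obtain ⟨K, hK, -⟩ := exists_isCO (J := U) Filter.univ_mem
  set φ₀ := quotBump hU hK
  have hφ₀ : I φ₀ ≠ 0 := hI.2 K hK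
  have huniq : ∀ I' : quotSchwartz hU →ₗ[ℂ] ℂ,
      (∀ (x : U) (φ : quotSchwartz hU), I' (quotTranslate hU x φ) = I' φ) →
      ∀ φ, I' φ = I' φ₀ / I φ₀ * I φ := by
    intro I' hI' φ
    have : I' (φ - (I φ / I φ₀) • φ₀) = 0 := by
      refine apply_eq_zero_of_invariant hUnion hI hI' ?_
      rw [map_sub, map_smul, smul_eq_mul, div_mul_cancel₀ _ hφ₀, sub_self]
    rw [map_sub, map_smul, smul_eq_mul, sub_eq_zero] at this
    rw [this]
    ring
  let conj : H → quotSchwartz hU →ₗ[ℂ] quotSchwartz hU := fun h =>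
    { toFun := quotConj hU h (hN h) (hN₀ h)
      map_add' := fun _ _ => rfl
      map_smul' := fun _ _ => rfl }
  have hconj : ∀ (I' : quotSchwartz hU →ₗ[ℂ] ℂ),
      (∀ (x : U) (φ : quotSchwartz hU), I' (quotTranslate hU x φ) = I' φ) → ∀ (h : H) (x : U) φ,
      (I' ∘ₗ conj h) (quotTranslate hU x φ) = (I' ∘ₗ conj h) φ := by
    intro I' hI' h x φ
    rw [LinearMap.comp_apply, LinearMap.comp_apply,
      ← hI' ⟨h * x * (h : G₀)⁻¹, (hN h _).1 x.2⟩ (conj h φ)]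
    congr 1
    refine Subtype.ext (funext fun u => congrArg φ.1 (Subtype.ext ?_))
    simp [mul_assoc]
  let m₀ : H →* ℂ :=
    { toFun := fun h => I (conj h φ₀) / I φ₀
      map_one' := by
        have : conj 1 φ₀ = φ₀ :=
          Subtype.ext (funext fun u => congrArg φ₀.1 (Subtype.ext (by simp)))
        rw [this, div_self hφ₀]
      map_mul' := fun h h' => by
        have : conj (h * h') φ₀ = conj h (conj h' φ₀) :=
          Subtype.ext (funext fun u => congrArg φ₀.1 (Subtype.ext (by simp [mul_assoc])))
        have h2 := huniq (I ∘ₗ conj h) (hconj I hI.1 h) (conj h' φ₀)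
        rw [LinearMap.comp_apply, LinearMap.comp_apply] at h2
        rw [this, h2]
        ring }
  have hm : IsQuotModule hU H hN hN₀ m₀.toHomUnits := by
    intro I' hI' h φ
    have h1 := huniq I' hI' φ
    have h2 := huniq I' hI' (conj h φ)
    have h3 := huniq (I ∘ₗ conj h) (hconj I hI.1 h) φ
    rw [LinearMap.comp_apply, LinearMap.comp_apply] at h3
    change I' (conj h φ) = I (conj h φ₀) / I φ₀ * I' φ
    rw [h2, h3, h1]
    ring
  refine ⟨m₀.toHomUnits, hm, fun m' hm' => MonoidHom.ext fun h => Units.ext ?_⟩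
  exact mul_right_cancel₀ hφ₀ ((hm' I hI.1 h φ₀).symm.trans (hm I hI.1 h φ₀))

/-- Elements of `H` near `1` conjugate the compact open `K` into itself, as do their inverses. They
fix the characteristic function of `U₀ K`, whose integral is nonzero, so the module is `1` on them.
-/
theorem IsQuotModule.isSmoothChar [IsLGroup U] {I : quotSchwartz hU →ₗ[ℂ] ℂ}
    (hI : IsInvariantIntegral hU I) {δ : H →* ℂˣ} (hδ : IsQuotModule hU H hN hN₀ δ⁻¹) :
    IsSmoothChar δ := by
  obtain ⟨K, hK, -⟩ := exists_isCO (J := U) Filter.univ_mem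
  have hev : ∀ᶠ h : H in 𝓝 1, ∀ k ∈ K,
      (⟨h * k * (h : G₀)⁻¹, (hN h _).1 k.2⟩ : U) ∈ K := by
    refine hK.2.eventually_forall_of_forall_eventually fun k hk => ?_
    have hc : Continuous fun p : H × U =>
        (⟨p.1 * p.2 * (p.1 : G₀)⁻¹, (hN p.1 _).1 p.2.2⟩ : U) := by fun_prop
    exact hc.continuousAt.preimage_mem_nhds (hK.1.mem_nhds (by simpa using hk))
  refine Subgroup.isOpen_of_mem_nhds _ (g := 1) ?_
  have hinv : ∀ᶠ h : H in 𝓝 1, ∀ k ∈ K,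
      (⟨(h⁻¹ : H) * k * ((h⁻¹ : H) : G₀)⁻¹, (hN h⁻¹ _).1 k.2⟩ : U) ∈ K :=
    (continuous_inv.tendsto' (1 : H) 1 inv_one).eventually hev
  filter_upwards [hev, hinv] with h h1 h2
  have hfix : quotConj hU h (hN h) (hN₀ h) (quotBump hU hK) = quotBump hU hK := by
    refine Subtype.ext (funext fun u => ?_)
    change (quotBump hU hK).1 ⟨(h : G₀)⁻¹ * u * h, _⟩ = _
    by_cases hu : ∃ l : U₀, ∃ k ∈ K, u = Subgroup.inclusion hU l * k
    · obtain ⟨l, k, hk, rfl⟩ := hu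
      rw [quotBump_mul hU hK l hk, ← quotBump_mul hU hK
        ⟨(h : G₀)⁻¹ * l * h, (hN₀ h _).2 (by simp [mul_assoc])⟩ (h2 k hk)]
      exact congrArg (quotBump hU hK).1 (Subtype.ext (by simp [mul_assoc]))
    · rw [quotBump_of_not_mem hU hK hu, quotBump_of_not_mem hU hK]
      rintro ⟨l, k, hk, e⟩
      refine hu ⟨⟨h * l * (h : G₀)⁻¹, (hN₀ h _).1 l.2⟩, _, h1 k hk, Subtype.ext ?_⟩
      have e' : (h : G₀)⁻¹ * u * h = l * k := congrArg Subtype.val e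
      have e'' : (u : G₀) = h * (l * k) * (h : G₀)⁻¹ := by
        rw [← e']
        group
      rw [e'']
      simp [mul_assoc]
  have := hδ I hI.1 h (quotBump hU hK)
  rw [hfix] at this
  have h3 : ((δ⁻¹ h : ℂˣ) : ℂ) = 1 :=
    (mul_eq_right₀ (hI.2 K hK)).1 this.symm
  have h4 : δ h = 1 := by
    rw [Units.val_eq_one, MonoidHom.inv_apply, inv_eq_one] at h3
    exact h3
  exact h4

end QuotModule

/-! ### Semidirect products -/

section Semidirect

variable {G₀ : Type*} [Group G₀]

/-- The inclusion of `G` in `G ⊔ U`. -/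
abbrev inl (G U : Subgroup G₀) : G →* (G ⊔ U : Subgroup G₀) := Subgroup.inclusion le_sup_left

/-- The inclusion of `U` in `G ⊔ U`. -/
abbrev inr (G U : Subgroup G₀) : U →* (G ⊔ U : Subgroup G₀) := Subgroup.inclusion le_sup_right

/-- `G` normalizes `U`. -/
abbrev Normalizes (G U : Subgroup G₀) : Prop :=
  ∀ (g : G) (u : G₀), u ∈ U ↔ (g : G₀) * u * (g : G₀)⁻¹ ∈ U

/-- Conjugation by an element that normalizes `U`. -/
def conjBy {G U : Subgroup G₀} (hN : Normalizes G U) (g : G) (u : U) : U :=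
  ⟨g * u * (g : G₀)⁻¹, (hN g _).1 u.2⟩

theorem exists_eq_mul {G U : Subgroup G₀} (hN : Normalizes G U) (x : (G ⊔ U : Subgroup G₀)) :
    ∃ (g : G) (u : U), x = inl G U g * inr G U u := by
  have hle : G ≤ Subgroup.normalizer (U : Set G₀) := fun g hg =>
    Subgroup.mem_normalizer_iff.2 fun u => hN ⟨g, hg⟩ u
  have hx : (x : G₀) ∈ ((G ⊔ U : Subgroup G₀) : Set G₀) := x.2
  rw [Subgroup.coe_mul_of_left_le_normalizer_right G U hle] at hx
  obtain ⟨g, hg, u, hu, e⟩ := Set.mem_mul.1 hx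
  exact ⟨⟨g, hg⟩, ⟨u, hu⟩, Subtype.ext e.symm⟩

variable [TopologicalSpace G₀] [IsTopologicalGroup G₀]

/-- `p` is a continuous projection of `G U` onto `G` with kernel `U`. -/
structure IsRetraction {G U : Subgroup G₀} (p : (G ⊔ U : Subgroup G₀) →* G) : Prop where
  continuous : Continuous p
  map_inl : ∀ g, p (inl G U g) = g
  map_inr : ∀ u, p (inr G U u) = 1

/-- Injectivity of `(g, u) ↦ g u` makes the `G`-component well defined, the embedding makes it
continuous, and normality of `U` makes it multiplicative. -/
theorem exists_isRetraction {G U : Subgroup G₀} (hN : Normalizes G U)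
    (hsemi : IsEmbedding (fun p : G × U => (p.1 : G₀) * (p.2 : G₀))) :
    ∃ p : (G ⊔ U : Subgroup G₀) →* G, IsRetraction p := by
  choose g u hgu using exists_eq_mul hN
  have uniq : ∀ (a : G) (b : U) (x : (G ⊔ U : Subgroup G₀)), (x : G₀) = a * b → g x = a := by
    intro a b x hx
    have h1 : (g x : G₀) * u x = a * b := (congrArg Subtype.val (hgu x)).symm.trans hx
    exact congrArg Prod.fst (hsemi.injective (a₁ := (g x, u x)) (a₂ := (a, b)) h1)
  have hc : Continuous fun x => (g x, u x) := by
    rw [hsemi.continuous_iff]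
    have : (fun p : G × U => (p.1 : G₀) * (p.2 : G₀)) ∘ (fun x => (g x, u x)) =
        fun x : (G ⊔ U : Subgroup G₀) => (x : G₀) :=
      funext fun x => (congrArg Subtype.val (hgu x)).symm
    rw [this]
    exact continuous_subtype_val
  refine ⟨⟨⟨g, uniq 1 1 1 (by simp)⟩, fun x y => uniq _
    ⟨(g y : G₀)⁻¹ * u x * g y * u y, U.mul_mem ?_ (u y).2⟩ _ ?_⟩, ⟨hc.fst, fun a => ?_, fun b => ?_⟩⟩
  · exact (hN (g y) _).2 (by simp [mul_assoc])
  · have h1 : (x : G₀) = g x * u x := congrArg Subtype.val (hgu x)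
    have h2 : (y : G₀) = g y * u y := congrArg Subtype.val (hgu y)
    rw [Subgroup.coe_mul, h1, h2]
    simp [mul_assoc]
  · exact uniq a 1 _ (by simp)
  · exact uniq 1 b _ (by simp)

namespace IsRetraction

variable {G U : Subgroup G₀} {p : (G ⊔ U : Subgroup G₀) →* G}

theorem mul_inv_mem (hp : IsRetraction p) (hN : Normalizes G U) (x : (G ⊔ U : Subgroup G₀)) :
    (x : G₀) * (p x : G₀)⁻¹ ∈ U := by
  obtain ⟨g, u, rfl⟩ := exists_eq_mul hN x
  rw [map_mul, hp.map_inl, hp.map_inr, mul_one]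
  exact (hN g _).1 u.2

/-- The `U`-component in the decomposition `x = u g`. -/
def fst (hp : IsRetraction p) (hN : Normalizes G U) (x : (G ⊔ U : Subgroup G₀)) : U :=
  ⟨x * (p x : G₀)⁻¹, hp.mul_inv_mem hN x⟩

theorem continuous_fst (hp : IsRetraction p) (hN : Normalizes G U) : Continuous (hp.fst hN) := by
  have := hp.continuous
  unfold fst
  fun_prop

theorem map_inclusion_mem (hp : IsRetraction p) {H U₀ : Subgroup G₀} (hN₀ : Normalizes H U₀)
    (hHG : H ≤ G) (hU : U₀ ≤ U) (hTS : H ⊔ U₀ ≤ G ⊔ U) (l : (H ⊔ U₀ : Subgroup G₀)) :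
    ∃ (h : H) (u : U₀), l = inl H U₀ h * inr H U₀ u ∧
      p (Subgroup.inclusion hTS l) = Subgroup.inclusion hHG h := by
  obtain ⟨h, u, rfl⟩ := exists_eq_mul hN₀ l
  refine ⟨h, u, rfl, ?_⟩
  rw [map_mul, map_mul]
  have h1 := hp.map_inl (Subgroup.inclusion hHG h)
  have h2 := hp.map_inr (Subgroup.inclusion hU u)
  change p (Subgroup.inclusion hTS (inl H U₀ h)) = _ at h1
  change p (Subgroup.inclusion hTS (inr H U₀ u)) = _ at h2
  rw [h1, h2, mul_one]

end IsRetraction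

end Semidirect

/-! ### Restriction to `U` -/

section Restriction

variable {G₀ : Type*} [Group G₀] [TopologicalSpace G₀] [IsTopologicalGroup G₀]
  {G H U U₀ : Subgroup G₀} {W : Type*} [AddCommGroup W] [Module ℂ W]
  {p : (G ⊔ U : Subgroup G₀) →* G}
  {τ : Representation ℂ (H ⊔ U₀ : Subgroup G₀) W}

/-- The restriction of functions from `G U` to `U`. -/
def resU (hp : IsRetraction p) (hN : Normalizes G U) (hN₀ : Normalizes H U₀) (hHG : H ≤ G)
    (hU : U₀ ≤ U) (hTS : H ⊔ U₀ ≤ G ⊔ U) (τ : Representation ℂ (H ⊔ U₀ : Subgroup G₀) W) :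
    cIndSpace hTS τ →ₗ[ℂ] cIndSpace hU (τ.comp (inr H U₀) : Representation ℂ U₀ W) where
  toFun f := ⟨fun u => f.1 (inr G U u), by
    obtain ⟨⟨K, hK⟩, heq, C, hC, hs⟩ := f.2
    refine ⟨⟨K.comap (inr G U) (isInducing_inclusion _).continuous,
      fun k hk u => ?_⟩, fun l u => ?_,
      -- If `u = h u₀ c`, applying `p` gives `h = p(c)⁻¹`, so `u = (h u₀ h⁻¹)(p(c)⁻¹ c)`. Thus the
      -- support lies in `U₀` times the image of `C` under `x ↦ p(x)⁻¹ x`.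
      (fun x : (G ⊔ U : Subgroup G₀) => (⟨(p x : G₀)⁻¹ * x, ?_⟩ : U)) '' C, hC.image ?_,
      fun u hu => ?_⟩
    · dsimp only
      rw [map_mul, hK _ hk]
    · dsimp only
      rw [map_mul]
      exact heq (inr H U₀ l) (inr G U u)
    · exact (hN (p x) _).2 (by simpa using hp.mul_inv_mem hN x)
    · have := hp.continuous
      fun_prop
    · obtain ⟨l, c, hc, e⟩ := hs _ hu
      obtain ⟨h, u₀, rfl, hph⟩ := hp.map_inclusion_mem hN₀ hHG hU hTS l
      have h1 : (h : G₀) * p c = 1 := by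
        have := congrArg p e
        rw [hp.map_inr, map_mul, hph] at this
        exact congrArg Subtype.val this.symm
      refine ⟨⟨h * u₀ * (h : G₀)⁻¹, (hN₀ h _).1 u₀.2⟩, _, ⟨c, hc, rfl⟩, Subtype.ext ?_⟩
      have e' : (u : G₀) = h * u₀ * c := congrArg Subtype.val e
      rw [e']
      simp [mul_assoc, eq_inv_of_mul_eq_one_left h1]⟩
  map_add' _ _ := rfl
  map_smul' _ _ := rfl

/-- A function in the induced space on `U` is equivariant under conjugation by small elements
of `H`. -/
theorem exists_conj_eq [IsLGroup G] (hN : Normalizes G U) (hN₀ : Normalizes H U₀) (hHG : H ≤ G)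
    (hU : U₀ ≤ U) (hτ : IsSmoothRep τ)
    (F : cIndSpace hU (τ.comp (inr H U₀) : Representation ℂ U₀ W)) :
    ∃ K : Subgroup G, IsCO K ∧ ∀ h : H, Subgroup.inclusion hHG h ∈ K → ∀ u : U,
      F.1 (conjBy hN (Subgroup.inclusion hHG h) u) = τ (inl H U₀ h) (F.1 u) := by
  have hlc := isLocallyConstant_of_mem_cIndSpace F.2
  obtain ⟨-, heq, C, hC, hs⟩ := F.2
  have hind := isInducing_inclusion hHG
  -- Near `h = 1` and a given point of `C`, both sides equal the value of `F` there, by local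
  -- constancy and smoothness of `τ`. Compactness makes this uniform on `C`, and `key` extends it to
  -- `U₀ C`.
  have hev : ∀ᶠ h : H in 𝓝 1, ∀ c ∈ C,
      F.1 (conjBy hN (Subgroup.inclusion hHG h) c) = τ (inl H U₀ h) (F.1 c) := by
    refine hC.eventually_forall_of_forall_eventually fun c _ => ?_
    have hcont : Continuous fun z : H × U => conjBy hN (Subgroup.inclusion hHG z.1) z.2 := by
      unfold conjBy
      fun_prop
    have h1 : ∀ᶠ z : H × U in 𝓝 (1, c),
        F.1 (conjBy hN (Subgroup.inclusion hHG z.1) z.2) = F.1 c := by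
      have := (hlc.comp_continuous hcont).eventually_eq (1, c)
      filter_upwards [this] with z hz
      rw [Function.comp_apply, Function.comp_apply] at hz
      rw [hz]
      exact congrArg F.1 (Subtype.ext (by simp [conjBy]))
    have h2 : ∀ᶠ z : H × U in 𝓝 (1, c), F.1 z.2 = F.1 c :=
      (continuous_snd.tendsto (1, c)).eventually (hlc.eventually_eq c)
    have h3 : ∀ᶠ z : H × U in 𝓝 (1, c), τ (inl H U₀ z.1) (F.1 c) = F.1 c := by
      have hc : Continuous fun z : H × U => inl H U₀ z.1 :=
        (isInducing_inclusion _).continuous.comp continuous_fst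
      exact hc.continuousAt.eventually ((hτ (F.1 c)).mem_nhds (by simp))
    filter_upwards [h1, h2, h3] with z e1 e2 e3
    rw [e1, e2, e3]
  rw [hind.nhds_eq_comap, map_one] at hev
  obtain ⟨N, hN1, hNsub⟩ := hev
  obtain ⟨K, hK, hKN⟩ := exists_isCO hN1
  refine ⟨K, hK, ?_⟩
  have key : ∀ h : H, Subgroup.inclusion hHG h ∈ K → ∀ (l : U₀), ∀ c ∈ C,
      F.1 (conjBy hN (Subgroup.inclusion hHG h) (Subgroup.inclusion hU l * c)) =
        τ (inl H U₀ h) (F.1 (Subgroup.inclusion hU l * c)) := by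
    intro h hh l c hc
    have h1 : conjBy hN (Subgroup.inclusion hHG h) (Subgroup.inclusion hU l * c) =
        Subgroup.inclusion hU (conjBy hN₀ h l) * conjBy hN (Subgroup.inclusion hHG h) c :=
      Subtype.ext (by simp [conjBy, mul_assoc])
    have h2 : F.1 (conjBy hN (Subgroup.inclusion hHG h) c) = τ (inl H U₀ h) (F.1 c) :=
      hNsub (hKN hh) c hc
    rw [h1, heq, heq, h2, MonoidHom.comp_apply, MonoidHom.comp_apply, ← Module.End.mul_apply,
      ← Module.End.mul_apply, ← map_mul, ← map_mul]
    congr 2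
    exact Subtype.ext (by simp [conjBy])
  intro h hh u
  by_cases hu : F.1 u = 0
  · rw [hu, map_zero]
    by_contra hne
    obtain ⟨l, c, hc, e⟩ := hs _ hne
    have h1 := key h⁻¹ (by rw [map_inv]; exact K.inv_mem hh) l c hc
    rw [← e] at h1
    have h2 : conjBy hN (Subgroup.inclusion hHG h⁻¹)
        (conjBy hN (Subgroup.inclusion hHG h) u) = u :=
      Subtype.ext (by simp [conjBy, mul_assoc])
    rw [h2, hu] at h1
    refine hne ?_
    have h3 := congrArg (τ (inl H U₀ h)) h1
    rw [map_zero, ← Module.End.mul_apply, ← map_mul, map_inv, mul_inv_cancel, map_one] at h3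
    exact h3.symm
  · obtain ⟨l, c, hc, rfl⟩ := hs u hu
    exact key h hh l c hc

open Classical in
/-- The extension of a function on `U` to `G U`, supported on `H U K`. -/
def extendFun (hp : IsRetraction p) (hN : Normalizes G U) (hHG : H ≤ G)
    (τ : Representation ℂ (H ⊔ U₀ : Subgroup G₀) W) (K : Subgroup G) (F : U → W) :
    (G ⊔ U : Subgroup G₀) → W := fun y =>
  if h : ∃ h : H, (Subgroup.inclusion hHG h)⁻¹ * p y ∈ K then
    τ (inl H U₀ h.choose)
      (F (conjBy hN (Subgroup.inclusion hHG h.choose)⁻¹ (hp.fst hN y))) else 0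

/-- Writing `p y = h k`, one has `y = h v k` with `v = h⁻¹ (hp.fst hN y) h`, and the value is `τ(h)
F(v)`. Another choice of `h` differs by an element of `H ∩ K`, for which `hF` is exactly the
compatibility required. -/
theorem extendFun_of_mem (hp : IsRetraction p) (hN : Normalizes G U) {hHG : H ≤ G}
    {K : Subgroup G} {F : U → W}
    (hF : ∀ h : H, Subgroup.inclusion hHG h ∈ K → ∀ u : U,
      F (conjBy hN (Subgroup.inclusion hHG h) u) = τ (inl H U₀ h) (F u))
    {y : (G ⊔ U : Subgroup G₀)} {h : H} (hh : (Subgroup.inclusion hHG h)⁻¹ * p y ∈ K) :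
    extendFun hp hN hHG τ K F y =
      τ (inl H U₀ h) (F (conjBy hN (Subgroup.inclusion hHG h)⁻¹ (hp.fst hN y))) := by
  have hex : ∃ h : H, (Subgroup.inclusion hHG h)⁻¹ * p y ∈ K := ⟨h, hh⟩
  rw [extendFun, dif_pos hex]
  have h2 := K.mul_mem hh (K.inv_mem hex.choose_spec)
  have h3 : Subgroup.inclusion hHG (h⁻¹ * hex.choose) ∈ K := by
    simpa [mul_assoc] using h2
  have h4 := hF _ h3 (conjBy hN (Subgroup.inclusion hHG hex.choose)⁻¹ (hp.fst hN y))
  have h5 : conjBy hN (Subgroup.inclusion hHG (h⁻¹ * hex.choose))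
      (conjBy hN (Subgroup.inclusion hHG hex.choose)⁻¹ (hp.fst hN y)) =
      conjBy hN (Subgroup.inclusion hHG h)⁻¹ (hp.fst hN y) :=
    Subtype.ext (by simp [conjBy, mul_assoc])
  rw [← h5, h4, ← Module.End.mul_apply, ← map_mul, ← map_mul, mul_inv_cancel_left]

/-- The restriction map to `U` is surjective. -/
theorem resU_surjective [IsLGroup G] [IsLGroup (G ⊔ U : Subgroup G₀)] (hp : IsRetraction p)
    (hN : Normalizes G U) (hN₀ : Normalizes H U₀) (hHG : H ≤ G)
    (hU : U₀ ≤ U) (hTS : H ⊔ U₀ ≤ G ⊔ U) (hτ : IsSmoothRep τ) :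
    Function.Surjective (resU hp hN hN₀ hHG hU hTS τ) := by
  intro F
  obtain ⟨K, hK, hF⟩ := exists_conj_eq hN hN₀ hHG hU hτ F
  have hlc := isLocallyConstant_of_mem_cIndSpace F.2
  obtain ⟨-, heq, C, hC, hs⟩ := id F.2
  set f := extendFun hp hN hHG τ K F.1 with hf
  have hf0 : ∀ y, (¬ ∃ h : H, (Subgroup.inclusion hHG h)⁻¹ * p y ∈ K) → f y = 0 :=
    fun y hy => dif_neg hy
  have hmem : f ∈ cIndSpace hTS τ := by
    refine mem_cIndSpace_of_isLocallyConstant (C := (fun z : U × G => inr G U z.1 *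
      inl G U z.2) '' (C ×ˢ (K : Set G))) ?_ (fun l y => ?_)
      ((hC.prod hK.2).image ?_) (fun y hy => ?_)
    · refine (IsLocallyConstant.iff_eventually_eq _).2 fun y => ?_
      by_cases hy : ∃ h : H, (Subgroup.inclusion hHG h)⁻¹ * p y ∈ K
      · obtain ⟨h, hh⟩ := hy
        have hc1 : Continuous fun y => (Subgroup.inclusion hHG h)⁻¹ * p y :=
          continuous_const.mul hp.continuous
        have hc2 : Continuous fun y =>
            conjBy hN (Subgroup.inclusion hHG h)⁻¹ (hp.fst hN y) := by
          have hc3 : Continuous (conjBy hN (Subgroup.inclusion hHG h)⁻¹) := by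
            unfold conjBy
            fun_prop
          exact hc3.comp (hp.continuous_fst hN)
        filter_upwards [hc1.continuousAt.preimage_mem_nhds (hK.1.mem_nhds hh),
          (hlc.comp_continuous hc2).eventually_eq y] with z hz1 hz2
        rw [Function.comp_apply, Function.comp_apply] at hz2
        rw [hf, extendFun_of_mem hp hN hF hh, extendFun_of_mem hp hN hF hz1, hz2]
      -- `H K` is clopen in `G`, so the function stays zero in a neighbourhood of a point outside
      -- its inverse image.
      · have hcl := (isClopen_doubleCoset (H.subgroupOf G) 1 ⟨K, hK.1⟩).compl.isOpen
        have hiff : ∀ z, (∃ h : H, (Subgroup.inclusion hHG h)⁻¹ * p z ∈ K) ↔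
            p z ∈ {x : G | ∃ h ∈ H.subgroupOf G, ∃ k ∈ (⟨K, hK.1⟩ : OpenSubgroup G),
              x = h * 1 * k} := by
          intro z
          constructor
          · rintro ⟨h, hh⟩
            exact ⟨Subgroup.inclusion hHG h, h.2, _, hh, by simp⟩
          · rintro ⟨h, hh, k, hk, e⟩
            refine ⟨⟨h, hh⟩, ?_⟩
            have : Subgroup.inclusion hHG ⟨h, hh⟩ = h := rfl
            rw [e, this, mul_one, inv_mul_cancel_left]
            exact hk
        have hny : p y ∈ {x : G | ∃ h ∈ H.subgroupOf G, ∃ k ∈ (⟨K, hK.1⟩ : OpenSubgroup G),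
              x = h * 1 * k}ᶜ := fun h => hy ((hiff y).2 h)
        filter_upwards [hp.continuous.continuousAt.preimage_mem_nhds (hcl.mem_nhds hny)] with z hz
        rw [hf0 y hy, hf0 z fun h => hz ((hiff z).1 h)]
    · obtain ⟨h₁, u₁, rfl, hph⟩ := hp.map_inclusion_mem hN₀ hHG hU hTS l
      have hpl : ∀ h : H, (Subgroup.inclusion hHG (h₁ * h))⁻¹ *
          p (Subgroup.inclusion hTS (inl H U₀ h₁ * inr H U₀ u₁) * y) =
          (Subgroup.inclusion hHG h)⁻¹ * p y := fun h => by
        rw [map_mul, map_mul p, hph]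
        group
      by_cases hy : ∃ h : H, (Subgroup.inclusion hHG h)⁻¹ * p y ∈ K
      · obtain ⟨h, hh⟩ := hy
        rw [hf, extendFun_of_mem hp hN hF hh,
          extendFun_of_mem hp hN hF (h := h₁ * h) (by rw [hpl]; exact hh)]
        have h5 : conjBy hN (Subgroup.inclusion hHG (h₁ * h))⁻¹ (hp.fst hN
            (Subgroup.inclusion hTS (inl H U₀ h₁ * inr H U₀ u₁) * y)) =
            Subgroup.inclusion hU (conjBy hN₀ h⁻¹ u₁) *
              conjBy hN (Subgroup.inclusion hHG h)⁻¹ (hp.fst hN y) := by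
          refine Subtype.ext ?_
          simp only [conjBy, IsRetraction.fst, map_mul p, hph]
          simp [mul_assoc]
        rw [h5, heq, MonoidHom.comp_apply, ← Module.End.mul_apply, ← Module.End.mul_apply,
          ← map_mul, ← map_mul]
        congr 2
        exact Subtype.ext (by simp [conjBy, mul_assoc])
      · rw [hf0 y hy, hf0, map_zero]
        rintro ⟨h, hh⟩
        refine hy ⟨h₁⁻¹ * h, ?_⟩
        rwa [← hpl, mul_inv_cancel_left]
    · exact ((isInducing_inclusion _).continuous.comp continuous_fst).mul
        ((isInducing_inclusion _).continuous.comp continuous_snd)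
    · by_cases hy' : ∃ h : H, (Subgroup.inclusion hHG h)⁻¹ * p y ∈ K
      · obtain ⟨h, hh⟩ := hy'
        rw [hf, extendFun_of_mem hp hN hF hh] at hy
        obtain ⟨l, c, hc, e⟩ := hs _ fun h0 => hy (by rw [h0, map_zero])
        refine ⟨inl H U₀ h * inr H U₀ l, _, ⟨(c, _), ⟨hc, hh⟩, rfl⟩, Subtype.ext ?_⟩
        have e' : (h : G₀)⁻¹ * (y * (p y : G₀)⁻¹) * h = l * c := by
          simpa [conjBy, IsRetraction.fst] using congrArg Subtype.val e
        have e'' : (y : G₀) = h * (l * c) * (h : G₀)⁻¹ * p y := by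
          rw [← e']
          group
        rw [e'']
        simp [mul_assoc]
      · exact absurd (hf0 y hy') hy
  refine ⟨⟨f, hmem⟩, Subtype.ext (funext fun u => ?_)⟩
  change f (inr G U u) = F.1 u
  rw [hf, extendFun_of_mem hp hN hF (h := 1) (by simp [hp.map_inr, K.one_mem]), map_one, map_one]
  exact congrArg F.1 (Subtype.ext (by simp [conjBy, IsRetraction.fst, hp.map_inr]))

end Restriction

/-! ### The isomorphism -/

section Isomorphism

variable {G₀ : Type*} [Group G₀] [TopologicalSpace G₀] [IsTopologicalGroup G₀]
  {G H U U₀ : Subgroup G₀} {W : Type*} [AddCommGroup W] [Module ℂ W]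
  {V : Type*} [AddCommGroup V] [Module ℂ V]
  {p : (G ⊔ U : Subgroup G₀) →* G}
  {τ : Representation ℂ (H ⊔ U₀ : Subgroup G₀) W}

/-- The map that applies a map on the induced space of `U` on every coset `U g`. -/
def fiberMap (hp : IsRetraction p) (hN : Normalizes G U) (hN₀ : Normalizes H U₀) (hHG : H ≤ G)
    (hU : U₀ ≤ U) (hTS : H ⊔ U₀ ≤ G ⊔ U)
    (A : cIndSpace hU (τ.comp (inr H U₀) : Representation ℂ U₀ W) →ₗ[ℂ] V) :
    cIndSpace hTS τ →ₗ[ℂ] (G → V) :=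
  LinearMap.pi fun g => A ∘ₗ resU hp hN hN₀ hHG hU hTS τ ∘ₗ cInd hTS τ (inl G U g)

variable {hp : IsRetraction p} {hN : Normalizes G U} {hN₀ : Normalizes H U₀} {hHG : H ≤ G}
    {hU : U₀ ≤ U} {hTS : H ⊔ U₀ ≤ G ⊔ U}
    {A : cIndSpace hU (τ.comp (inr H U₀) : Representation ℂ U₀ W) →ₗ[ℂ] V}

theorem fiberMap_apply (f : cIndSpace hTS τ) (g : G) :
    fiberMap hp hN hN₀ hHG hU hTS A f g =
      A (resU hp hN hN₀ hHG hU hTS τ (cInd hTS τ (inl G U g) f)) := rfl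

theorem fiberMap_cInd_inl (x : G) (f : cIndSpace hTS τ) (g : G) :
    fiberMap hp hN hN₀ hHG hU hTS A (cInd hTS τ (inl G U x) f) g =
      fiberMap hp hN hN₀ hHG hU hTS A f (g * x) := by
  rw [fiberMap_apply, fiberMap_apply, map_mul, map_mul, Module.End.mul_apply]

/-- Moving `u` past `g` turns it into `g u g⁻¹`, on which `θ` takes the same value. -/
theorem fiberMap_cInd_inr {θ : U →* ℂˣ} (hA : ∀ u F, A (cInd hU _ u F) = (θ u : ℂ) • A F)
    (hθ : ∀ g u, θ (conjBy hN g u) = θ u) (u : U) (f : cIndSpace hTS τ) :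
    fiberMap hp hN hN₀ hHG hU hTS A (cInd hTS τ (inr G U u) f) =
      (θ u : ℂ) • fiberMap hp hN hN₀ hHG hU hTS A f := by
  ext g
  rw [Pi.smul_apply, fiberMap_apply, fiberMap_apply, ← hθ g u, ← hA]
  congr 1
  refine Subtype.ext (funext fun y => ?_)
  exact congrArg f.1 (Subtype.ext (by simp [conjBy, mul_assoc]))

/-- Multiplication by the indicator of the inverse image of a left `H`-invariant clopen set. -/
def mulIndicator [IsLGroup (G ⊔ U : Subgroup G₀)] (hp : IsRetraction p) (hN₀ : Normalizes H U₀)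
    (hHG : H ≤ G) (hU : U₀ ≤ U) (hTS : H ⊔ U₀ ≤ G ⊔ U)
    (τ : Representation ℂ (H ⊔ U₀ : Subgroup G₀) W) {B : Set G} (hB : IsClopen B)
    (hinv : ∀ h ∈ H.subgroupOf G, ∀ a, h * a ∈ B ↔ a ∈ B) :
    cIndSpace hTS τ →ₗ[ℂ] cIndSpace hTS τ where
  toFun f := ⟨(p ⁻¹' B).indicator f.1, indicator_mem_cIndSpace f.2 (hB.preimage hp.continuous)
    fun l a => by
      obtain ⟨h, u, -, hph⟩ := hp.map_inclusion_mem hN₀ hHG hU hTS l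
      rw [Set.mem_preimage, map_mul, hph]
      exact hinv _ h.2 _⟩
  map_add' f f' := Subtype.ext (Set.indicator_add _ _ _)
  map_smul' a f := Subtype.ext (funext fun x => Set.indicator_const_smul_apply _ a f.1 x)

theorem fiberMap_mulIndicator [IsLGroup (G ⊔ U : Subgroup G₀)] {B : Set G} (hB : IsClopen B)
    (hinv : ∀ h ∈ H.subgroupOf G, ∀ a, h * a ∈ B ↔ a ∈ B) (f : cIndSpace hTS τ) :
    fiberMap hp hN hN₀ hHG hU hTS A (mulIndicator hp hN₀ hHG hU hTS τ hB hinv f) =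
      B.indicator (fiberMap hp hN hN₀ hHG hU hTS A f) := by
  ext g
  have hpug : ∀ u, p (inr G U u * inl G U g) = g := fun u => by
    rw [map_mul, hp.map_inl, hp.map_inr, one_mul]
  by_cases hg : g ∈ B
  · rw [Set.indicator_of_mem hg, fiberMap_apply, fiberMap_apply]
    congr 1
    refine Subtype.ext (funext fun u => ?_)
    exact Set.indicator_of_mem (by rw [Set.mem_preimage, hpug]; exact hg) _
  · rw [Set.indicator_of_notMem hg, fiberMap_apply, ← map_zero A]
    congr 1
    refine Subtype.ext (funext fun u => ?_)
    exact Set.indicator_of_notMem (by rw [Set.mem_preimage, hpug]; exact hg) _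

/-- `p ⁻¹' B` is stable under right translation by `U`, so the cutoff commutes with the action of
`U`. -/
theorem mulIndicator_mem_jacquetKer [IsLGroup (G ⊔ U : Subgroup G₀)] {θ : U →* ℂˣ} {B : Set G}
    (hB : IsClopen B) (hinv : ∀ h ∈ H.subgroupOf G, ∀ a, h * a ∈ B ↔ a ∈ B)
    {f : cIndSpace hTS τ} (hf : f ∈ jacquetKer (U := U) le_sup_right θ (cInd hTS τ)) :
    mulIndicator hp hN₀ hHG hU hTS τ hB hinv f ∈
      jacquetKer (U := U) le_sup_right θ (cInd hTS τ) := by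
  have hle : jacquetKer (U := U) le_sup_right θ (cInd hTS τ) ≤
      (jacquetKer (U := U) le_sup_right θ (cInd hTS τ)).comap
        (mulIndicator hp hN₀ hHG hU hTS τ hB hinv) := by
    refine Submodule.span_le.2 ?_
    rintro _ ⟨u, v, rfl⟩
    refine Submodule.subset_span ⟨u, mulIndicator hp hN₀ hHG hU hTS τ hB hinv v, ?_⟩
    rw [map_sub, map_smul]
    congr 1
    refine Subtype.ext (funext fun y => ?_)
    change (p ⁻¹' B).indicator (fun y => v.1 (y * inr G U u)) y =
      (p ⁻¹' B).indicator v.1 (y * inr G U u)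
    have : p (y * inr G U u) = p y := by rw [map_mul, hp.map_inr, mul_one]
    by_cases hy : p y ∈ B
    · rw [Set.indicator_of_mem (by exact hy),
        Set.indicator_of_mem (by rw [Set.mem_preimage, this]; exact hy)]
    · rw [Set.indicator_of_notMem (by exact hy),
        Set.indicator_of_notMem (by rw [Set.mem_preimage, this]; exact hy)]
  exact hle hf

theorem cInd_inl_mem_jacquetKer {θ : U →* ℂˣ} (hθ : ∀ g u, θ (conjBy hN g u) = θ u) (g : G)
    {f : cIndSpace hTS τ} (hf : f ∈ jacquetKer (U := U) le_sup_right θ (cInd hTS τ)) :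
    cInd hTS τ (inl G U g) f ∈ jacquetKer (U := U) le_sup_right θ (cInd hTS τ) := by
  have hle : jacquetKer (U := U) le_sup_right θ (cInd hTS τ) ≤
      (jacquetKer (U := U) le_sup_right θ (cInd hTS τ)).comap (cInd hTS τ (inl G U g)) := by
    refine Submodule.span_le.2 ?_
    rintro _ ⟨u, v, rfl⟩
    refine Submodule.subset_span ⟨conjBy hN g u, cInd hTS τ (inl G U g) v, ?_⟩
    rw [map_sub, map_smul, hθ, ← Module.End.mul_apply, ← Module.End.mul_apply, ← map_mul,
      ← map_mul]
    congr 3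
    exact Subtype.ext (by simp [conjBy])
  exact hle hf

/-- Twisted translates on `U` extend to twisted translates on `G U`. -/
theorem exists_mem_jacquetKer_resU_eq [IsLGroup G] [IsLGroup (G ⊔ U : Subgroup G₀)]
    (hτ : IsSmoothRep τ) {θ : U →* ℂˣ} {F : U → W}
    (hF : F ∈ funKer hU (τ.comp (inr H U₀) : Representation ℂ U₀ W) θ) :
    ∃ n ∈ jacquetKer (U := U) le_sup_right θ (cInd hTS τ),
      (resU hp hN hN₀ hHG hU hTS τ n).1 = F := by
  have hle : funKer hU (τ.comp (inr H U₀) : Representation ℂ U₀ W) θ ≤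
      (jacquetKer (U := U) le_sup_right θ (cInd hTS τ)).map
        ((cIndSpace hU _).subtype ∘ₗ resU hp hN hN₀ hHG hU hTS τ) := by
    refine Submodule.span_le.2 ?_
    rintro _ ⟨u, F, hF, rfl⟩
    obtain ⟨f, hf⟩ := resU_surjective hp hN hN₀ hHG hU hTS hτ ⟨F, hF⟩
    refine ⟨cInd hTS τ (inr G U u) f - (θ u : ℂ) • f, Submodule.subset_span ⟨u, f, rfl⟩, ?_⟩
    have hf' : ∀ y, f.1 (inr G U y) = F y := fun y => congrFun (congrArg Subtype.val hf) y
    ext y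
    change f.1 (inr G U y * inr G U u) - (θ u : ℂ) • f.1 (inr G U y) = _
    rw [← map_mul, hf', hf']
    rfl
  obtain ⟨n, hn, e⟩ := hle hF
  exact ⟨n, hn, e⟩

/-- The support of a function in the induced space is compact modulo `H U`. -/
theorem exists_compact_support (hp : IsRetraction p) (hN₀ : Normalizes H U₀) (hHG : H ≤ G)
    (hU : U₀ ≤ U) (f : cIndSpace hTS τ) : ∃ C : Set G, IsCompact C ∧
      ∀ x, f.1 x ≠ 0 → ∃ h ∈ H.subgroupOf G, ∃ c ∈ C, p x = h * c := by
  obtain ⟨-, -, C, hC, hs⟩ := f.2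
  refine ⟨p '' C, hC.image hp.continuous, fun x hx => ?_⟩
  obtain ⟨l, c, hc, rfl⟩ := hs x hx
  obtain ⟨h, u, -, hph⟩ := hp.map_inclusion_mem hN₀ hHG hU hTS l
  exact ⟨_, h.2, p c, ⟨c, hc, rfl⟩, by rw [map_mul, hph]⟩

/-- Vanishing at `g` puts the restriction of `f` to the fibre over `g` in the span of twisted
translates. That relation lifts to `GU` and persists over a neighbourhood of `H g`, where it can be
cut out by an indicator. -/
theorem mem_jacquetKer_of_fiberMap_eq_zero [IsLGroup G] [IsLGroup (G ⊔ U : Subgroup G₀)]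
    (hτ : IsSmoothRep τ) {θ : U →* ℂˣ} (hθ : ∀ g u, θ (conjBy hN g u) = θ u)
    (hA : ∀ F, A F = 0 → F.1 ∈ funKer hU (τ.comp (inr H U₀) : Representation ℂ U₀ W) θ)
    {f : cIndSpace hTS τ} (hf : fiberMap hp hN hN₀ hHG hU hTS A f = 0) :
    f ∈ jacquetKer (U := U) le_sup_right θ (cInd hTS τ) := by
  set N := jacquetKer (U := U) le_sup_right θ (cInd hTS τ) with hNdef
  suffices h : f.1 ∈ N.map (cIndSpace hTS τ).subtype by
    obtain ⟨n, hn, e⟩ := h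
    rwa [← show n = f from Subtype.ext e]
  obtain ⟨C, hC, hs⟩ := exists_compact_support hp hN₀ hHG hU f
  refine mem_of_locally_mem (H.subgroupOf G) p _ ?_ hC hs fun g => ?_
  · rintro B hB hinv _ ⟨n, hn, rfl⟩
    exact ⟨_, mulIndicator_mem_jacquetKer (hp := hp) (hN₀ := hN₀) (hHG := hHG) (hU := hU)
      hB hinv hn, rfl⟩
  · set f₁ := cInd hTS τ (inl G U g) f with hf₁
    obtain ⟨n, hn, hnf⟩ := exists_mem_jacquetKer_resU_eq (hp := hp) (hN := hN) (hN₀ := hN₀)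
      (hHG := hHG) hτ (hA (resU hp hN hN₀ hHG hU hTS τ f₁) (congrFun hf g))
    obtain ⟨⟨K, hK⟩, heq, -⟩ := (f₁ - n).2
    have hzero : ∀ u, (f₁ - n).1 (inr G U u) = 0 := fun u => by
      have : n.1 (inr G U u) = f₁.1 (inr G U u) := congrFun hnf u
      change f₁.1 (inr G U u) - n.1 (inr G U u) = 0
      rw [this, sub_self]
    let K' : OpenSubgroup G := K.comap (inl G U) (isInducing_inclusion _).continuous
    set B : Set G := {x | ∃ h ∈ H.subgroupOf G, ∃ k ∈ K', x = h * 1 * k} with hBdef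
    have hB : IsClopen B := isClopen_doubleCoset _ _ _
    have hinv : ∀ h ∈ H.subgroupOf G, ∀ a, h * a ∈ B ↔ a ∈ B := by
      intro h hh a
      constructor
      · rintro ⟨h', hh', k, hk, e⟩
        exact ⟨h⁻¹ * h', mul_mem (inv_mem hh) hh', k, hk, by
          rw [mul_assoc, mul_assoc, ← mul_assoc h', ← e, inv_mul_cancel_left]⟩
      · rintro ⟨h', hh', k, hk, rfl⟩
        exact ⟨h * h', mul_mem hh hh', k, hk, by simp [mul_assoc]⟩
    -- A point over `H K'` has the form `h v k` with `v ∈ U`. Left equivariance and right invariance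
    -- reduce to `v`, where `f₁ - n` vanishes.
    have hvan : ∀ x, p x ∈ B → f₁.1 x = n.1 x := by
      rintro x ⟨h, hh, k, hk, e⟩
      rw [mul_one] at e
      obtain ⟨v, hv⟩ : ∃ v : U, x = Subgroup.inclusion hTS (inl H U₀ ⟨h, hh⟩) *
          (inr G U v * inl G U k) := by
        refine ⟨⟨(h : G₀)⁻¹ * (x * (p x : G₀)⁻¹) * h, (hN h _).2 ?_⟩, Subtype.ext ?_⟩
        · simpa [mul_assoc] using hp.mul_inv_mem hN x
        · have e' : (p x : G₀) = h * k := congrArg Subtype.val e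
          simp [e', mul_assoc]
      have h1 : (f₁ - n).1 x = 0 := by
        rw [hv, heq, hK (inl G U k) hk, hzero, map_zero]
      exact sub_eq_zero.1 h1
    -- `B' = B g` is the corresponding neighbourhood of `g`, undoing the translation from `f` to
    -- `f₁`.
    set B' : Set G := (fun x => x * g⁻¹) ⁻¹' B with hB'
    have hinv' : ∀ h ∈ H.subgroupOf G, ∀ a, h * a ∈ B' ↔ a ∈ B' := fun h hh a => by
      rw [hB', Set.mem_preimage, Set.mem_preimage, mul_assoc]
      exact hinv h hh _
    refine ⟨B', hB.preimage (continuous_mul_const _), hinv', ⟨1, one_mem _, 1, one_mem _,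
      by simp⟩, ?_⟩
    refine ⟨cInd hTS τ (inl G U g⁻¹) (mulIndicator hp hN₀ hHG hU hTS τ hB hinv n),
      cInd_inl_mem_jacquetKer (hN := hN) hθ _ (mulIndicator_mem_jacquetKer hB hinv hn), ?_⟩
    ext x
    change (p ⁻¹' B).indicator n.1 (x * inl G U g⁻¹) = _
    have hpx : p (x * inl G U g⁻¹) = p x * g⁻¹ := by rw [map_mul, hp.map_inl]
    by_cases hx : p x * g⁻¹ ∈ B
    · rw [Set.indicator_of_mem (by rw [Set.mem_preimage, hpx]; exact hx),
        Set.indicator_of_mem (by exact hx), ← hvan _ (by rw [hpx]; exact hx)]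
      change f.1 (x * inl G U g⁻¹ * inl G U g) = _
      rw [mul_assoc, ← map_mul, inv_mul_cancel, map_one, mul_one]
    · rw [Set.indicator_of_notMem (by rw [Set.mem_preimage, hpx]; exact hx),
        Set.indicator_of_notMem (by exact hx)]

theorem fiberMap_mem_cIndSpace [IsLGroup G] {π : Representation ℂ H V}
    (heq : ∀ (h : H) (f : cIndSpace hTS τ) (g : G),
      fiberMap hp hN hN₀ hHG hU hTS A f (Subgroup.inclusion hHG h * g) =
        π h (fiberMap hp hN hN₀ hHG hU hTS A f g)) (f : cIndSpace hTS τ) :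
    fiberMap hp hN hN₀ hHG hU hTS A f ∈ cIndSpace hHG π := by
  obtain ⟨C, hC, hs⟩ := exists_compact_support hp hN₀ hHG hU f
  obtain ⟨K, hK⟩ := f.2.1
  refine ⟨⟨K.comap (inl G U) (isInducing_inclusion _).continuous, fun k hk g => ?_⟩,
    fun h g => heq h f g, C, hC, fun g hg => ?_⟩
  · have : cInd hTS τ (inl G U k) f = f := Subtype.ext (funext fun x => hK _ hk x)
    rw [← fiberMap_cInd_inl, this]
  · by_contra hne
    refine hg ?_
    rw [fiberMap_apply, ← map_zero A]
    congr 1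
    refine Subtype.ext (funext fun u => ?_)
    by_contra hu
    obtain ⟨h, hh, c, hc, e⟩ := hs (inr G U u * inl G U g) hu
    rw [map_mul, hp.map_inl, hp.map_inr, one_mul] at e
    exact hne ⟨⟨h, hh⟩, c, hc, e⟩

/-- A value at `g` is lifted through `A` and `resU`. Both the resulting image and `f'` are left
`H`-equivariant and right invariant under a common open subgroup, so they agree on a double coset of
`g`, and such local solutions are glued. -/
theorem exists_fiberMap_eq [IsLGroup G] [IsLGroup (G ⊔ U : Subgroup G₀)] (hτ : IsSmoothRep τ)
    {π : Representation ℂ H V} (heq : ∀ (h : H) (f : cIndSpace hTS τ) (g : G),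
      fiberMap hp hN hN₀ hHG hU hTS A f (Subgroup.inclusion hHG h * g) =
        π h (fiberMap hp hN hN₀ hHG hU hTS A f g))
    (hA : Function.Surjective A) {f' : G → V} (hf' : f' ∈ cIndSpace hHG π) :
    ∃ f, fiberMap hp hN hN₀ hHG hU hTS A f = f' := by
  suffices h : f' ∈ LinearMap.range (fiberMap hp hN hN₀ hHG hU hTS A) from h
  obtain ⟨⟨K₁, hK₁⟩, heq', C, hC, hs⟩ := hf'
  refine mem_of_locally_mem (H.subgroupOf G) (id : G → G) _ ?_ hC ?_ fun g => ?_
  · rintro B hB hinv _ ⟨f, rfl⟩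
    exact ⟨_, fiberMap_mulIndicator hB hinv f⟩
  · intro x hx
    obtain ⟨h, c, hc, e⟩ := hs x hx
    exact ⟨_, h.2, c, hc, e⟩
  · obtain ⟨F, hF⟩ := hA (f' g)
    obtain ⟨f, hf⟩ := resU_surjective hp hN hN₀ hHG hU hTS hτ F
    set f₁ := cInd hTS τ (inl G U g⁻¹) f
    have hg : fiberMap hp hN hN₀ hHG hU hTS A f₁ g = f' g := by
      rw [fiberMap_cInd_inl, mul_inv_cancel, fiberMap_apply, map_one, map_one,
        Module.End.one_apply, hf, hF]
    obtain ⟨⟨K₂, hK₂⟩, -⟩ := fiberMap_mem_cIndSpace heq f₁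
    set B : Set G := {x | ∃ h ∈ H.subgroupOf G, ∃ k ∈ K₁ ⊓ K₂, x = h * g * k} with hBdef
    have hB : IsClopen B := isClopen_doubleCoset _ _ _
    have hinv : ∀ h ∈ H.subgroupOf G, ∀ a, h * a ∈ B ↔ a ∈ B := by
      intro h hh a
      constructor
      · rintro ⟨h', hh', k, hk, e⟩
        exact ⟨h⁻¹ * h', mul_mem (inv_mem hh) hh', k, hk, by
          rw [mul_assoc, mul_assoc, ← mul_assoc h', ← e, inv_mul_cancel_left]⟩
      · rintro ⟨h', hh', k, hk, rfl⟩
        exact ⟨h * h', mul_mem hh hh', k, hk, by simp [mul_assoc]⟩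
    refine ⟨B, hB, hinv, ⟨1, one_mem _, 1, one_mem _, by simp⟩,
      mulIndicator hp hN₀ hHG hU hTS τ hB hinv f₁, ?_⟩
    rw [fiberMap_mulIndicator, Set.preimage_id]
    refine Set.indicator_congr ?_
    rintro _ ⟨h, hh, k, hk, rfl⟩
    obtain ⟨h1, h2⟩ := OpenSubgroup.mem_inf.1 hk
    rw [hK₁ k h1, hK₂ k h2]
    have e1 := heq ⟨h, hh⟩ f₁ g
    have e2 := heq' ⟨h, hh⟩ g
    rw [hg] at e1
    exact e1.trans e2.symm

/-- This is where the module enters: the integrand for `h g` at `u` is `σ h` of the integrand for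
`g` at `h⁻¹ u h`. -/
theorem fiberMap_mul_left {θ : U →* ℂˣ} {hθ : IsSmoothChar θ}
    (hGθ : ∀ g u, θ (conjBy hN g u) = θ u) {I : quotSchwartz hU →ₗ[ℂ] ℂ}
    (hI : IsInvariantIntegral hU I) {q : W →ₗ[ℂ] V}
    {hq : ∀ l w, q ((τ.comp (inr H U₀) : Representation ℂ U₀ W) l w) =
      (θ (Subgroup.inclusion hU l) : ℂ) • q w}
    (hA : ∀ (ev : V →ₗ[ℂ] ℂ) F, ev (A F) = I (dualComp hU ev (twistMap hU hθ q hq F)))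
    {σ : Representation ℂ H V} (hσ : ∀ h w, q (τ (inl H U₀ h) w) = σ h (q w))
    {hNH : Normalizes H U} {m : H →* ℂˣ} (hm : IsQuotModule hU H hNH hN₀ m)
    (h : H) (f : cIndSpace hTS τ) (g : G) :
    fiberMap hp hN hN₀ hHG hU hTS A f (Subgroup.inclusion hHG h * g) =
        twist σ m h (fiberMap hp hN hN₀ hHG hU hTS A f g) := by
  refine eq_of_forall_dual fun ev => ?_
  change _ = ev ((m h : ℂ) • σ h _)
  rw [map_smul, ← LinearMap.comp_apply ev, fiberMap_apply, fiberMap_apply, hA, hA, smul_eq_mul,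
    ← hm I hI.1 h]
  congr 1
  refine Subtype.ext (funext fun u => ?_)
  set v : U := conjBy hN (Subgroup.inclusion hHG h)⁻¹ u with hv
  have e1 : (θ u)⁻¹ = (θ v)⁻¹ := by rw [hv, hGθ]
  have e2 : f.1 (inr G U u * inl G U (Subgroup.inclusion hHG h * g)) =
      τ (inl H U₀ h) (f.1 (inr G U v * inl G U g)) := by
    rw [← f.2.2.1]
    exact congrArg f.1 (Subtype.ext (by simp [hv, conjBy, mul_assoc]))
  have e3 : (⟨(h : G₀)⁻¹ * u * h, (hNH h _).2 (by simp [mul_assoc])⟩ : U) = v :=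
    Subtype.ext (by simp [hv, conjBy])
  change ev ((θ u)⁻¹ • q (f.1 (inr G U u * inl G U (Subgroup.inclusion hHG h * g)))) =
    (dualComp hU (ev ∘ₗ σ h) (twistMap hU hθ q hq
      (resU hp hN hN₀ hHG hU hTS τ (cInd hTS τ (inl G U g) f)))).1
      ⟨(h : G₀)⁻¹ * u * h, (hNH h _).2 (by simp [mul_assoc])⟩
  rw [e3]
  change _ = ev (σ h (((θ v)⁻¹ : ℂˣ) • q (f.1 (inr G U v * inl G U g))))
  rw [e1, e2, hσ]
  congr 1
  exact (map_smul (σ h) (((θ v)⁻¹ : ℂˣ) : ℂ) _).symm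

end Isomorphism

/-- The isomorphism, for the character by which `H` scales a given invariant integral. -/
theorem nonempty_equiv_of_isInvariantIntegral
    {G₀ : Type*} [Group G₀] [TopologicalSpace G₀] [IsTopologicalGroup G₀]
    {G H U U₀ : Subgroup G₀} [IsLGroup G] [IsLGroup U] [IsLGroup (G ⊔ U : Subgroup G₀)]
    (hHG : H ≤ G) (hU : U₀ ≤ U) (hTS : H ⊔ U₀ ≤ G ⊔ U) (hUnion : IsUnionOfCompactOpen U)
    {θ : U →* ℂˣ} (hθ : IsSmoothChar θ) (hGθ : (G : Set G₀) ⊆ charNormalizer U θ)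
    (hHθ₀ : (H : Set G₀) ⊆ charNormalizer U₀ (θ.comp (Subgroup.inclusion hU)))
    (hsemi : Topology.IsEmbedding (fun p : G × U => (p.1 : G₀) * (p.2 : G₀)))
    {W : Type*} [AddCommGroup W] [Module ℂ W]
    {τ : Representation ℂ (H ⊔ U₀ : Subgroup G₀) W} (hτ : IsSmoothRep τ)
    {I : quotSchwartz hU →ₗ[ℂ] ℂ} (hI : IsInvariantIntegral hU I)
    {hNH : Normalizes H U} {hN₀ : Normalizes H U₀} {m : H →* ℂˣ}
    (hm : IsQuotModule hU H hNH hN₀ m) :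
    Nonempty (Representation.Equiv
      (jacquet (J := G ⊔ U) (U := U) (L := G) le_sup_right le_sup_left θ hGθ (cInd hTS τ))
      (cInd hHG (twist (jacquet (J := H ⊔ U₀) (U := U₀) (L := H) le_sup_right le_sup_left
        (θ.comp (Subgroup.inclusion hU)) hHθ₀ τ) m))) := by
  have hN : Normalizes G U := mem_iff_conj_mem hGθ
  have hθG : ∀ g u, θ (conjBy hN g u) = θ u := fun g u => (hGθ g.2 u).2
  obtain ⟨p, hp⟩ := exists_isRetraction hN hsemi
  let N₀ := jacquetKer (J := H ⊔ U₀) (U := U₀) le_sup_right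
    (θ.comp (Subgroup.inclusion hU)) τ
  let σ : Representation ℂ H (W ⧸ N₀) :=
    jacquet (J := H ⊔ U₀) (U := U₀) (L := H) le_sup_right le_sup_left
      (θ.comp (Subgroup.inclusion hU)) hHθ₀ τ
  have hρ : IsSmoothRep (τ.comp (inr H U₀) : Representation ℂ U₀ W) := fun w =>
    (hτ w).preimage (isInducing_inclusion _).continuous
  have hq : ∀ l w, N₀.mkQ ((τ.comp (inr H U₀) : Representation ℂ U₀ W) l w) =
      (θ (Subgroup.inclusion hU l) : ℂ) • N₀.mkQ w := by
    intro l w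
    rw [← map_smul, ← sub_eq_zero, ← map_sub, Submodule.mkQ_apply,
      Submodule.Quotient.mk_eq_zero]
    exact Submodule.subset_span ⟨l, w, rfl⟩
  obtain ⟨A, hA, hAθ, hAker, hAsurj⟩ := exists_twistedIntegral hUnion hρ hθ hI N₀.mkQ hq
    -- The Jacquet kernel of `τ` for `U₀` is by definition `twistKer` of its restriction to `U₀`.
    (by rw [Submodule.ker_mkQ]; exact le_of_eq rfl)
  set Φ := fiberMap hp hN hN₀ hHG hU hTS A
  have heq : ∀ (h : H) (f : cIndSpace hTS τ) (g : G),
      Φ f (Subgroup.inclusion hHG h * g) = twist σ m h (Φ f g) :=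
    fiberMap_mul_left hθG hI hA (σ := σ) (fun h w => rfl) hm
  let Φ' : cIndSpace hTS τ →ₗ[ℂ] cIndSpace hHG (twist σ m) :=
    Φ.codRestrict _ (fiberMap_mem_cIndSpace heq)
  have hker : jacquetKer (U := U) le_sup_right θ (cInd hTS τ) = LinearMap.ker Φ' := by
    refine le_antisymm (Submodule.span_le.2 ?_) fun f hf => ?_
    · rintro _ ⟨u, f, rfl⟩
      refine Subtype.ext ?_
      change Φ (cInd hTS τ (inr G U u) f - (θ u : ℂ) • f) = 0
      rw [map_sub, map_smul, fiberMap_cInd_inr hAθ hθG, sub_self]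
    · exact mem_jacquetKer_of_fiberMap_eq_zero (hp := hp) (hN := hN) (hN₀ := hN₀) (hHG := hHG)
        (hU := hU) hτ hθG hAker (congrArg Subtype.val hf)
  have hsurj : Function.Surjective Φ' := fun f' => by
    obtain ⟨f, hf⟩ := exists_fiberMap_eq (hp := hp) (hN := hN) (hN₀ := hN₀) (hU := hU) hτ heq
      (fun v => by
        obtain ⟨w, rfl⟩ := N₀.mkQ_surjective v
        exact hAsurj w) f'.2
    exact ⟨f, Subtype.ext hf⟩
  refine ⟨Representation.Equiv.mk ((Submodule.quotEquivOfEq _ _ hker).trans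
    (Φ'.quotKerEquivOfSurjective hsurj)) fun g => ?_⟩
  refine Submodule.linearMap_qext _ (LinearMap.ext fun f => Subtype.ext (funext fun x => ?_))
  exact fiberMap_cInd_inl g f x

end TwistedJacquet

end

/-! ### The proposition -/

open TwistedJacquet
theorem mainTheorem9
    {G₀ : Type*} [Group G₀] [TopologicalSpace G₀] [IsLGroup G₀]
    (G H U U₀ : Subgroup G₀)
    (hG : IsClosed (G : Set G₀)) (hH : IsClosed (H : Set G₀))
    (hU : IsClosed (U : Set G₀)) (hU₀ : IsClosed (U₀ : Set G₀))
    (hHG : H ≤ G) (hU₀U : U₀ ≤ U)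
    (hGU_bot : G ⊓ U = ⊥)
    (hUnion : IsUnionOfCompactOpen U)
    (θ : U →* ℂˣ) (hθ : IsSmoothChar θ)
    -- `G` normalizes `U` and `θ`
    (hGθ : (G : Set G₀) ⊆ charNormalizer U θ)
    -- `H` normalizes `U₀` and `θ₀ = θ|_{U₀}`
    (hHθ₀ : (H : Set G₀) ⊆ charNormalizer U₀ (θ.comp (Subgroup.inclusion hU₀U)))
    -- `G ⊔ U` is `GU` and `H ⊔ U₀` is `HU₀`, because of the normalization hypotheses
    (hGU : IsClosed ((G ⊔ U : Subgroup G₀) : Set G₀))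
    (hHU₀ : IsClosed ((H ⊔ U₀ : Subgroup G₀) : Set G₀))
    -- `GU` is the topological semidirect product of `G` and `U`
    (hsemi : Topology.IsEmbedding (fun p : G × U => (p.1 : G₀) * (p.2 : G₀)))
    {W : Type*} [AddCommGroup W] [Module ℂ W]
    (τ : Representation ℂ (H ⊔ U₀ : Subgroup G₀) W) (hτ : IsSmoothRep τ) :
    -- the module of the action of `H` on `U₀ \ U` is well defined
    (∃! m : H →* ℂˣ, IsQuotModule hU₀U H
      (mem_iff_conj_mem (θ := θ) (fun _ hh => hGθ (hHG hh))) (mem_iff_conj_mem hHθ₀) m) ∧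
    -- if `δ` is its inverse, then `δ` is a smooth character and the isomorphism holds
    ∀ δ : H →* ℂˣ,
      IsQuotModule hU₀U H (mem_iff_conj_mem (θ := θ) (fun _ hh => hGθ (hHG hh))) (mem_iff_conj_mem hHθ₀) δ⁻¹ →
      IsSmoothChar δ ∧
      Nonempty (Representation.Equiv
        (jacquet (J := G ⊔ U) (U := U) (L := G) le_sup_right le_sup_left θ hGθ
          (cInd (sup_le_sup hHG hU₀U) τ))
        (cInd hHG
          (twist
            (jacquet (J := H ⊔ U₀) (U := U₀) (L := H) le_sup_right le_sup_left
              (θ.comp (Subgroup.inclusion hU₀U)) hHθ₀ τ)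
            δ⁻¹))) := by 
  have : IsLGroup G := .of_isClosed hG
  have : IsLGroup U := .of_isClosed hU
  have : IsLGroup U₀ := .of_isClosed hU₀
  have : IsLGroup (G ⊔ U : Subgroup G₀) := .of_isClosed hGU
  obtain ⟨I, hI⟩ := exists_isInvariantIntegral hU₀U hU₀ hUnion
  refine ⟨existsUnique_isQuotModule hI hUnion, fun δ hδ => ⟨hδ.isSmoothChar hI, ?_⟩⟩
  exact nonempty_equiv_of_isInvariantIntegral hHG hU₀U _ hUnion hθ hGθ hHθ₀ hsemi hτ hI hδ
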